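/- Let $n\ge 0$ and $N\ge 2$ be integers, and let $\mu_1,\dots,\mu_N$ be Borel probability measures on $\mathbb{R}^n$ with finite second moments, such that $\mu_1$ is absolutely continuous with respect to Lebesgue measure. Put $c(x_1,\dots,x_N)=\sum_{1\le i<j\le N}\langle x_i,x_j\rangle$ and $X_k=\operatorname{Spt}(\mu_k)$, and let $\Pi(\mu_1,\dots,\mu_N)$ be the set of Borel probability measures on $(\mathbb{R}^n)^N$ with marginals $\mu_1,\dots,\mu_N$. Then $c$ is $\lambda$-integrable for every $\lambda\in\Pi(\mu_1,\dots,\mu_N)$, and the problem $$\sup_{\lambda\in\Pi(\mu_1,\dots,\mu_N)}\int c\,d\lambda$$ is attained by exactly one $\lambda$. This $\lambda$ is induced by a measurable map: $\lambda=(\mathrm{id},T_2,\dots,T_N)_\#\mu_1$. The maps $T_j$ are described as follows. The dual problem is to minimize $\sum_k\int\varphi_k\,d\mu_k$ over functions $\varphi_k:\mathbb{R}^n\to(-\infty,+\infty]$ that are $\mu_k$-a.e. finite and $\mu_k$-integrable and satisfy $\sum_k\varphi_k(x_k)\ge c(x_1,\dots,x_N)$ on $\prod_k X_k$. It has a solution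 $(\varphi_1,\dots,\varphi_N)$ that is conjugate, i.e. for all $j$ and all $x_j\in\mathbb{R}^n$ $$\varphi_j(x_j)=\sup\Big\{c(x_1,\dots,x_N)-\sum_{k\ne j}\varphi_k(x_k)\ :\ x_k\in X_k\ (k\ne j)\Big\}.$$ For every conjugate solution of the dual problem, $\varphi_1$ is differentiable (and finite nearby) at $\mu_1$-a.e. point. For $j\in\{2,\dots,N\}$ let $$u_j(t)=\tfrac12|t|^2+\sup\Big\{\Big\langle t,\sum_{k\ne 1,j}x_k\Big\rangle+\sum_{\substack{i<k\\ i,k\notin\{1,j\}}}\langle x_i,x_k\rangle-\sum_{k\ne1,j}\varphi_k(x_k)\ :\ x_k\in X_k\ (k\ne 1,j)\Big\}.$$ Then $u_j:\mathbb{R}^n\to(-\infty,+\infty]$ is proper and strictly convex on its effective domain, its Legendre transform $u_j^*(y)=\sup_t\{\langle t,y\rangle-u_j(t)\}$ is finite and differentiable on $\mathbb{R}^n$, and $$T_j(x_1)=Du_j^*\big(x_1+D\varphi_1(x_1)\big)-x_1\qquad\text{for }\mu_1\text{-a.e. }x_1 .$$ -/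

import Mathlib

open MeasureTheory Filter Topology

noncomputable section

/-- Euclidean space `ℝⁿ`. -/
abbrev Eucl (n : ℕ) : Type := EuclideanSpace ℝ (Fin n)

/-- The surplus `c(x₁, …, x_N) = ∑_{i < j} ⟨x_i, x_j⟩`. -/
def surplus {n N : ℕ} (x : Fin N → Eucl n) : ℝ :=
  ∑ i, ∑ j ∈ Finset.Ioi i, inner ℝ (x i) (x j)

/-- `Π(μ₁, …, μ_N)`: the Borel probability measures on `(ℝⁿ)^N` with marginals `μ₁, …, μ_N`. -/
def plans {n N : ℕ} (μ : Fin N → Measure (Eucl n)) : Set (Measure (Fin N → Eucl n)) :=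
  {P | IsProbabilityMeasure P ∧ ∀ k, P.map (fun x => x k) = μ k}

/-- `P` solves `sup { ∫ c dP : P ∈ Π(μ₁, …, μ_N) }`, that is, it attains the supremum. -/
def IsOptimalPlan {n N : ℕ} (μ : Fin N → Measure (Eucl n))
    (P : Measure (Fin N → Eucl n)) : Prop :=
  P ∈ plans μ ∧ ∀ Q ∈ plans μ, ∫ x, surplus x ∂Q ≤ ∫ x, surplus x ∂P

/-- Admissible potentials: `φ_k : ℝⁿ → (-∞, +∞]`, finite `μ_k`-a.e. and `μ_k`-integrable, with
`∑_k φ_k(x_k) ≥ c(x₁, …, x_N)` for all `x_k` in the support of `μ_k`. -/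
structure IsDualAdmissible {n N : ℕ} (μ : Fin N → Measure (Eucl n))
    (φ : Fin N → Eucl n → EReal) : Prop where
  ne_bot : ∀ k x, φ k x ≠ ⊥
  ae_ne_top : ∀ k, ∀ᵐ x ∂μ k, φ k x ≠ ⊤
  integrable : ∀ k, Integrable (fun x => (φ k x).toReal) (μ k)
  le_sum : ∀ x : Fin N → Eucl n, (∀ k, x k ∈ (μ k).support) →
    (surplus x : EReal) ≤ ∑ k, φ k (x k)

/-- `φ` solves the dual problem `inf ∑_k ∫ φ_k dμ_k` over the admissible potentials. -/
def IsDualSolution {n N : ℕ} (μ : Fin N → Measure (Eucl n))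
    (φ : Fin N → Eucl n → EReal) : Prop :=
  IsDualAdmissible μ φ ∧ ∀ χ, IsDualAdmissible μ χ →
    ∑ k, ∫ x, (φ k x).toReal ∂μ k ≤ ∑ k, ∫ x, (χ k x).toReal ∂μ k

/-- For each `j` and each `x_j ∈ ℝⁿ`,
`φ_j(x_j) = sup { c(x₁, …, x_N) - ∑_{k ≠ j} φ_k(x_k) : x_k ∈ Spt μ_k for k ≠ j }`. -/
def IsConjugateTuple {n N : ℕ} (μ : Fin N → Measure (Eucl n))
    (φ : Fin N → Eucl n → EReal) : Prop :=
  ∀ (j : Fin N) (y : Eucl n),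
    φ j y = ⨆ (x : Fin N → Eucl n) (_ : x j = y) (_ : ∀ k, k ≠ j → x k ∈ (μ k).support),
      ((surplus x : EReal) - ∑ k ∈ Finset.univ.erase j, φ k (x k))

/-- The indices other than `j` and the first one. -/
def otherIndices {N : ℕ} [NeZero N] (j : Fin N) : Finset (Fin N) :=
  Finset.univ.filter fun k => k ≠ 0 ∧ k ≠ j

/-- `ψ_j(t)`: the supremum, over `x_k ∈ Spt μ_k` for `k ≠ 1, j`, of
`⟨t, ∑_{k ≠ 1, j} x_k⟩ + ∑_{i < k; i, k ≠ 1, j} ⟨x_i, x_k⟩ - ∑_{k ≠ 1, j} φ_k(x_k)`.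
The coordinates `x₁` and `x_j` of the bound variable do not enter. -/
def reducedPotential {n N : ℕ} [NeZero N] (μ : Fin N → Measure (Eucl n))
    (φ : Fin N → Eucl n → EReal) (j : Fin N) (t : Eucl n) : EReal :=
  ⨆ (x : Fin N → Eucl n) (_ : ∀ k ∈ otherIndices j, x k ∈ (μ k).support),
    (((inner ℝ t (∑ k ∈ otherIndices j, x k)
        + ∑ i ∈ otherIndices j, ∑ k ∈ (otherIndices j).filter (fun k => i < k),
            inner ℝ (x i) (x k) : ℝ) : EReal)
      - ∑ k ∈ otherIndices j, φ k (x k))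

/-- `u_j(t) = |t|² / 2 + ψ_j(t)`. -/
def uFun {n N : ℕ} [NeZero N] (μ : Fin N → Measure (Eucl n))
    (φ : Fin N → Eucl n → EReal) (j : Fin N) (t : Eucl n) : EReal :=
  ((‖t‖ ^ 2 / 2 : ℝ) : EReal) + reducedPotential μ φ j t

/-- The Legendre transform `f^*(y) = sup_t (⟨t, y⟩ - f(t))`. -/
def legendre {n : ℕ} (f : Eucl n → EReal) (y : Eucl n) : EReal :=
  ⨆ t : Eucl n, (((inner ℝ t y : ℝ) : EReal) - f t)

/-- `f : ℝⁿ → (-∞, +∞]` is proper and is strictly convex on its effective domain. -/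
structure IsProperStrictConvex {n : ℕ} (f : Eucl n → EReal) : Prop where
  ne_bot : ∀ t, f t ≠ ⊥
  nonempty : ∃ t, f t ≠ ⊤
  strict : StrictConvexOn ℝ {t | f t ≠ ⊤} (fun t => (f t).toReal)

/-- An extended-real function is finite near `x` and differentiable at `x`. -/
def EDifferentiableAt {n : ℕ} (f : Eucl n → EReal) (x : Eucl n) : Prop :=
  (∀ᶠ y in 𝓝 x, f y ≠ ⊥ ∧ f y ≠ ⊤) ∧ DifferentiableAt ℝ (fun y => (f y).toReal) x

/-- The gradient `Df(x)`, meaningful where `EDifferentiableAt f x` holds. -/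
def egrad {n : ℕ} (f : Eucl n → EReal) (x : Eucl n) : Eucl n :=
  gradient (fun y => (f y).toReal) x

end

/-! The proof is dual. Weak duality bounds `∫ c` over plans by the value of any admissible tuple, so
it suffices to find a dual solution and a plan on which `c = ∑ φ_k` almost everywhere.

Existence of a dual solution uses no compactness of the supports. Potentials are damped to `exp (-(f
+ N|x|² + C) / 2)`. The damping of an average is the geometric mean of the dampings, which makes the
damped energy uniformly convex; suitable minimizing sequences are then Cauchy in L² after damping
and converge almost everywhere, and Fatou's lemma passes to the limit
(`exists_realAdmissible_minimizer`). Replacing the potentials one index at a time by conjugates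
yields a conjugate solution (`exists_conjugate_isDualSolution`).

For a conjugate solution `φ₁` is a supremum of affine functions, hence differentiable `μ₁`-a.e. Let
`x` be a maximizer in the conjugacy formula for `φ₁(x₁)` at such a point. Then `∑_{k ≠ 1} x_k =
Dφ₁(x₁)`. Moreover, apart from `⟨x₁, x_j⟩`, the surplus sees `x₁` and `x_j` only through `t = x₁ +
x_j`, so the sum of the remaining points is a subgradient of `ψ_j` at `t`. Hence `x₁ + Dφ₁(x₁)` is a
subgradient of `u_j` at `t`, and strong convexity gives `t = Du_j^*(x₁ + Dφ₁(x₁))`, that is, `x_j =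
T_j(x₁)`. The same argument with errors shows that near maximizers are close to `(T_j(x₁))_j`
(`exists_norm_sub_transportMap_le`), so maximizing sequences converge and the maximum is attained.

That `T_j` carries `μ₁` to `μ_j` is the Euler–Lagrange equation of the dual problem: perturbing
`φ_j` by `εg` changes the conjugate at `x₁` to first order by `-ε g(T_j(x₁))` (`map_transportMap`).
The induced plan thus attains the dual value, and any plan doing so is concentrated on the graph of
`T` (`ae_eq_transportMap`). This gives optimality, uniqueness, and independence of the chosen dual
solution. -/

/-! ### Algebra and growth of the surplus. -/

/-- `∑_{i < k; i, k ∈ S} ⟨x_i, x_k⟩`. -/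
noncomputable def pairSum {n N : ℕ} (S : Finset (Fin N)) (x : Fin N → Eucl n) : ℝ :=
  ∑ i ∈ S, ∑ k ∈ S.filter (fun k => i < k), inner ℝ (x i) (x k)

theorem surplus_eq_pairSum {n N : ℕ} (x : Fin N → Eucl n) :
    surplus x = pairSum Finset.univ x := by
  unfold surplus pairSum
  refine Finset.sum_congr rfl fun i _ => Finset.sum_congr ?_ fun _ _ => rfl
  ext k; simp

theorem pairSum_insert {n N : ℕ} {S : Finset (Fin N)} {j : Fin N} (hj : j ∉ S)
    (x : Fin N → Eucl n) :
    pairSum (insert j S) x = inner ℝ (x j) (∑ k ∈ S, x k) + pairSum S x := by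
  unfold pairSum
  rw [Finset.sum_insert hj]
  simp only [Finset.sum_filter]
  rw [Finset.sum_insert hj]
  simp only [lt_self_iff_false, if_false, zero_add]
  simp_rw [Finset.sum_insert hj]
  rw [Finset.sum_add_distrib, ← add_assoc, ← Finset.sum_add_distrib, inner_sum]
  congr 1
  refine Finset.sum_congr rfl fun k hk => ?_
  have hne : k ≠ j := fun h => hj (h ▸ hk)
  rcases lt_or_gt_of_ne hne with h | h
  · simp [h, h.not_gt, real_inner_comm]
  · simp [h, h.not_gt]

theorem pairSum_congr {n N : ℕ} {S : Finset (Fin N)} {x y : Fin N → Eucl n}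
    (h : ∀ k ∈ S, x k = y k) : pairSum S x = pairSum S y := by
  unfold pairSum
  refine Finset.sum_congr rfl fun i hi => Finset.sum_congr rfl fun k hk => ?_
  rw [h i hi, h k (Finset.mem_filter.1 hk).1]

theorem surplus_eq_inner_add {n N : ℕ} (x : Fin N → Eucl n) (j : Fin N) :
    surplus x = inner ℝ (x j) (∑ k ∈ Finset.univ.erase j, x k)
      + pairSum (Finset.univ.erase j) x := by
  rw [surplus_eq_pairSum, ← pairSum_insert (Finset.notMem_erase j _),
    Finset.insert_erase (Finset.mem_univ j)]

theorem univ_erase_zero_eq {N : ℕ} [NeZero N] {j : Fin N} (hj : j ≠ 0) :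
    (Finset.univ : Finset (Fin N)).erase 0 = insert j (otherIndices j) := by
  ext k
  by_cases h : k = j <;> simp [otherIndices, h, hj]

theorem notMem_otherIndices {N : ℕ} [NeZero N] (j : Fin N) : j ∉ otherIndices j := by
  simp [otherIndices]

/-- Apart from their mutual product, the first and the `j`-th point enter only through their sum.
This is why `ψ_j` is evaluated at `x₁ + x_j`. -/
theorem surplus_eq_otherIndices {n N : ℕ} [NeZero N] {j : Fin N} (hj : j ≠ 0)
    (x : Fin N → Eucl n) :
    surplus x = inner ℝ (x 0) (x j) + inner ℝ (x 0 + x j) (∑ k ∈ otherIndices j, x k)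
      + pairSum (otherIndices j) x := by
  rw [surplus_eq_inner_add x 0, univ_erase_zero_eq hj, pairSum_insert (notMem_otherIndices j),
    Finset.sum_insert (notMem_otherIndices j), inner_add_right, inner_add_left]
  ring

theorem continuous_surplus {n N : ℕ} : Continuous (surplus : (Fin N → Eucl n) → ℝ) := by
  unfold surplus
  fun_prop

theorem abs_surplus_le {n N : ℕ} (x : Fin N → Eucl n) :
    |surplus x| ≤ N * ∑ k, ‖x k‖ ^ 2 := by
  have hpair : ∀ i k : Fin N, |inner ℝ (x i) (x k)| ≤ (‖x i‖ ^ 2 + ‖x k‖ ^ 2) / 2 := fun i k => by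
    have := abs_real_inner_le_norm (x i) (x k)
    nlinarith [sq_nonneg (‖x i‖ - ‖x k‖)]
  calc |surplus x| ≤ ∑ i, ∑ k ∈ Finset.Ioi i, |inner ℝ (x i) (x k)| :=
        (Finset.abs_sum_le_sum_abs _ _).trans
          (Finset.sum_le_sum fun i _ => Finset.abs_sum_le_sum_abs _ _)
    _ ≤ ∑ i, ∑ k, (‖x i‖ ^ 2 + ‖x k‖ ^ 2) / 2 := by
        refine Finset.sum_le_sum fun i _ => ?_
        refine (Finset.sum_le_sum fun k _ => hpair i k).trans ?_
        exact Finset.sum_le_sum_of_subset_of_nonneg (Finset.subset_univ _)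
          fun _ _ _ => by positivity
    _ = N * ∑ k, ‖x k‖ ^ 2 := by
        simp only [← Finset.sum_div, Finset.sum_add_distrib, Finset.sum_const, Finset.card_univ,
          Fintype.card_fin, nsmul_eq_mul, ← Finset.mul_sum]
        ring

/-! ### Finite sums in `(-∞, +∞]`. -/

theorem EReal.sum_ne_bot {ι : Type*} (s : Finset ι) (f : ι → EReal) (h : ∀ k ∈ s, f k ≠ ⊥) :
    ∑ k ∈ s, f k ≠ ⊥ := by
  classical
  induction s using Finset.induction_on with
  | empty => simp
  | insert a s ha ih =>
    rw [Finset.sum_insert ha]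
    simp only [ne_eq, EReal.add_eq_bot_iff, not_or]
    exact ⟨h a (by simp), ih fun k hk => h k (by simp [hk])⟩

theorem EReal.sum_eq_top {ι : Type*} {s : Finset ι} {f : ι → EReal} (h : ∀ k ∈ s, f k ≠ ⊥)
    {j : ι} (hj : j ∈ s) (hf : f j = ⊤) : ∑ k ∈ s, f k = ⊤ := by
  classical
  rw [← Finset.add_sum_erase s f hj, hf]
  exact EReal.top_add_of_ne_bot (EReal.sum_ne_bot _ _ fun k hk => h k (Finset.mem_of_mem_erase hk))

theorem EReal.sum_eq_coe_sum_toReal {ι : Type*} {s : Finset ι} {f : ι → EReal}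
    (h : ∀ k ∈ s, f k ≠ ⊥) (h' : ∀ k ∈ s, f k ≠ ⊤) :
    ∑ k ∈ s, f k = ((∑ k ∈ s, (f k).toReal : ℝ) : EReal) := by
  classical
  induction s using Finset.induction_on with
  | empty => simp
  | insert a s ha ih =>
    rw [Finset.sum_insert ha, Finset.sum_insert ha, EReal.coe_add,
      ih (fun k hk => h k (by simp [hk])) (fun k hk => h' k (by simp [hk])),
      EReal.coe_toReal (h' a (by simp)) (h a (by simp))]

/-! ### Suprema of affine functions. -/

/-- A function `ℝⁿ → (-∞, +∞]` that is a supremum of a nonempty family of affine functions. -/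
def IsAffineSup {n : ℕ} (f : Eucl n → EReal) : Prop :=
  ∃ S : Set (Eucl n × ℝ), S.Nonempty ∧
    ∀ t, f t = ⨆ p ∈ S, ((inner ℝ t p.1 + p.2 : ℝ) : EReal)

namespace IsAffineSup

variable {n : ℕ} {f : Eucl n → EReal}

theorem exists_affine_le (hf : IsAffineSup f) :
    ∃ (a : Eucl n) (b : ℝ), ∀ t, ((inner ℝ t a + b : ℝ) : EReal) ≤ f t := by
  obtain ⟨S, ⟨p, hp⟩, h⟩ := hf
  refine ⟨p.1, p.2, fun t => ?_⟩
  rw [h t]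
  exact le_iSup₂ (f := fun (p : Eucl n × ℝ) (_ : p ∈ S) => ((inner ℝ t p.1 + p.2 : ℝ) : EReal)) p hp

theorem ne_bot (hf : IsAffineSup f) (t : Eucl n) : f t ≠ ⊥ := by
  obtain ⟨a, b, h⟩ := hf.exists_affine_le
  exact fun h0 => absurd (h t) (by rw [h0]; simp)

theorem lowerSemicontinuous (hf : IsAffineSup f) : LowerSemicontinuous f := by
  obtain ⟨S, -, h⟩ := hf
  have : f = fun t => ⨆ p ∈ S, ((inner ℝ t p.1 + p.2 : ℝ) : EReal) := funext h
  rw [this]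
  refine lowerSemicontinuous_biSup fun p _ => Continuous.lowerSemicontinuous ?_
  exact continuous_coe_real_ereal.comp (by fun_prop)

theorem measurable (hf : IsAffineSup f) : Measurable f := hf.lowerSemicontinuous.measurable

theorem apply_add_smul_le (hf : IsAffineSup f) {s t : Eucl n} (hs : f s ≠ ⊤) (ht : f t ≠ ⊤)
    {a b : ℝ} (ha : 0 ≤ a) (hb : 0 ≤ b) (hab : a + b = 1) :
    f (a • s + b • t) ≤ ((a * (f s).toReal + b * (f t).toReal : ℝ) : EReal) := by
  have hs' := EReal.coe_toReal hs (hf.ne_bot s)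
  have ht' := EReal.coe_toReal ht (hf.ne_bot t)
  obtain ⟨S, -, h⟩ := hf
  rw [h]
  refine iSup₂_le fun p hp => ?_
  have key : ∀ r, (((f r).toReal : ℝ) : EReal) = f r → inner ℝ r p.1 + p.2 ≤ (f r).toReal := by
    intro r hr
    rw [← EReal.coe_le_coe_iff, hr, h r]
    exact le_iSup₂ (f := fun (p : Eucl n × ℝ) (_ : p ∈ S) => ((inner ℝ r p.1 + p.2 : ℝ) : EReal))
      p hp
  rw [EReal.coe_le_coe_iff, inner_add_left, real_inner_smul_left, real_inner_smul_left]
  have h1 := mul_le_mul_of_nonneg_left (key s hs') ha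
  have h2 := mul_le_mul_of_nonneg_left (key t ht') hb
  have h3 : p.2 = a * p.2 + b * p.2 := by rw [← add_mul, hab, one_mul]
  linarith

theorem convex_domain (hf : IsAffineSup f) : Convex ℝ {t | f t ≠ ⊤} := by
  intro s hs t ht a b ha hb hab h
  have := hf.apply_add_smul_le hs ht ha hb hab
  rw [h] at this
  exact EReal.coe_ne_top _ (top_le_iff.1 this)

theorem convexOn_toReal (hf : IsAffineSup f) :
    ConvexOn ℝ {t | f t ≠ ⊤} (fun t => (f t).toReal) := by
  refine ⟨hf.convex_domain, fun s hs t ht a b ha hb hab => ?_⟩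
  have := hf.apply_add_smul_le hs ht ha hb hab
  rw [← EReal.coe_toReal (hf.convex_domain hs ht ha hb hab) (hf.ne_bot _),
    EReal.coe_le_coe_iff] at this
  simpa using this

/-- The domain is convex, so its frontier is Lebesgue null. In its interior the function is locally
Lipschitz, and Rademacher's theorem applies on each member of a countable cover. -/
theorem ae_eDifferentiableAt (hf : IsAffineSup f) {ν : Measure (Eucl n)} (hν : ν ≪ volume)
    (h : ∀ᵐ x ∂ν, f x ≠ ⊤) : ∀ᵐ x ∂ν, EDifferentiableAt f x := by
  have hfr : ∀ᵐ x ∂ν, x ∉ frontier {t | f t ≠ ⊤} := by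
    refine hν.ae_le ?_
    exact measure_eq_zero_iff_ae_notMem.1 (hf.convex_domain.addHaar_frontier volume)
  have hlip := hf.convexOn_toReal.locallyLipschitzOn_interior
  have hloc : ∀ x ∈ interior {t | f t ≠ ⊤}, ∃ u ∈ 𝓝[interior {t | f t ≠ ⊤}] x,
      ∀ᵐ y, y ∈ u → DifferentiableWithinAt ℝ (fun t => (f t).toReal) u y := by
    intro x hx
    obtain ⟨K, u, hu, hK⟩ := hlip hx
    exact ⟨u, hu, hK.ae_differentiableWithinAt_of_mem⟩
  choose! u hu hd using hloc
  obtain ⟨c, hc, hcount, hcov⟩ := TopologicalSpace.countable_cover_nhdsWithin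
    (f := fun x => interior (u x)) (s := interior {t | f t ≠ ⊤}) fun x hx => by
      have := hu x hx
      rw [isOpen_interior.nhdsWithin_eq hx] at this ⊢
      exact interior_mem_nhds.2 this
  have hae : ∀ᵐ y, ∀ x ∈ c, y ∈ u x → DifferentiableWithinAt ℝ (fun t => (f t).toReal) (u x) y :=
    (ae_ball_iff hcount).2 fun x hx => hd x (hc hx)
  filter_upwards [h, hfr, hν.ae_le hae] with y hy hyf hyd
  have hyi : y ∈ interior {t | f t ≠ ⊤} := by
    by_contra hn
    exact hyf ⟨subset_closure hy, hn⟩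
  refine ⟨?_, ?_⟩
  · filter_upwards [mem_interior_iff_mem_nhds.1 hyi] with z hz
    exact ⟨hf.ne_bot z, hz⟩
  · obtain ⟨x, hx, hyx⟩ := Set.mem_iUnion₂.1 (hcov hyi)
    exact (hyd x hx (interior_subset hyx)).differentiableAt (mem_interior_iff_mem_nhds.1 hyx)

end IsAffineSup

/-! ### Proximal points and the Legendre transform of a quadratic perturbation. -/

/-- `t ↦ |t|² / 2 + f(t)`. -/
noncomputable def quadAdd {n : ℕ} (f : Eucl n → EReal) (t : Eucl n) : EReal :=
  ((‖t‖ ^ 2 / 2 : ℝ) : EReal) + f t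

/-- `y - t` is a subgradient of `f` at `t`, that is, `t` is the proximal point of `y`. -/
def IsProx {n : ℕ} (f : Eucl n → EReal) (y t : Eucl n) : Prop :=
  f t ≠ ⊤ ∧ ∀ s, (((f t).toReal + inner ℝ (s - t) (y - t) : ℝ) : EReal) ≤ f s

namespace IsAffineSup

variable {n : ℕ} {f : Eucl n → EReal}

theorem quadAdd_ne_top_iff (t : Eucl n) : quadAdd f t ≠ ⊤ ↔ f t ≠ ⊤ := by
  unfold quadAdd
  rw [not_iff_not]
  constructor
  · intro h
    by_contra hn
    exact absurd h (EReal.add_lt_top (EReal.coe_ne_top _) hn).ne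
  · intro h
    rw [h, EReal.coe_add_top]

theorem quadAdd_ne_bot (hf : IsAffineSup f) (t : Eucl n) : quadAdd f t ≠ ⊥ := by
  unfold quadAdd
  simp [EReal.add_eq_bot_iff, hf.ne_bot t, -EReal.coe_pow]

theorem quadAdd_eq_coe (hf : IsAffineSup f) {t : Eucl n} (ht : f t ≠ ⊤) :
    quadAdd f t = ((‖t‖ ^ 2 / 2 + (f t).toReal : ℝ) : EReal) := by
  unfold quadAdd
  rw [EReal.coe_add, EReal.coe_toReal ht (hf.ne_bot t)]

theorem isProperStrictConvex_quadAdd (hf : IsAffineSup f) (h : ∃ t, f t ≠ ⊤) :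
    IsProperStrictConvex (quadAdd f) := by
  refine ⟨hf.quadAdd_ne_bot, ?_, ?_⟩
  · obtain ⟨t, ht⟩ := h
    exact ⟨t, (quadAdd_ne_top_iff t).2 ht⟩
  · simp_rw [quadAdd_ne_top_iff]
    refine ⟨hf.convex_domain, fun s hs t ht hst a b ha hb hab => ?_⟩
    have hc := hf.convexOn_toReal.2 hs ht ha.le hb.le hab
    have hm := hf.convex_domain hs ht ha.le hb.le hab
    simp only [hf.quadAdd_eq_coe hs, hf.quadAdd_eq_coe ht, hf.quadAdd_eq_coe hm,
      EReal.toReal_coe, smul_eq_mul] at hc ⊢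
    have hb' : b = 1 - a := by linarith
    have hpos : 0 < a * b * ‖s - t‖ ^ 2 := by
      have : 0 < ‖s - t‖ := norm_pos_iff.2 (sub_ne_zero.2 hst)
      positivity
    have hn : ‖a • s + b • t‖ ^ 2 = a * ‖s‖ ^ 2 + b * ‖t‖ ^ 2 - a * b * ‖s - t‖ ^ 2 := by
      rw [norm_add_sq_real, norm_sub_sq_real, norm_smul, norm_smul, real_inner_smul_left,
        real_inner_smul_right, Real.norm_of_nonneg ha.le, Real.norm_of_nonneg hb.le, hb']
      ring
    rw [hn]
    linarith

/-- The point minimizes `f(t) + |t|²/2 - ⟨t, y⟩`, which is lower semicontinuous and coercive because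
`f` has an affine minorant. Comparing the minimum with points on the segment towards `s`, at
parameter `l`, gives the subgradient inequality up to an error of order `l`. -/
theorem exists_isProx (hf : IsAffineSup f) (h : ∃ t, f t ≠ ⊤) (y : Eucl n) :
    ∃ t, IsProx f y t := by
  obtain ⟨t₁, ht₁⟩ := h
  obtain ⟨a, b, hab⟩ := hf.exists_affine_le
  set F : Eucl n → EReal := fun t => f t + ((‖t‖ ^ 2 / 2 - inner ℝ t y : ℝ) : EReal) with hF
  have hFcoe : ∀ t, f t ≠ ⊤ →
      F t = (((f t).toReal + (‖t‖ ^ 2 / 2 - inner ℝ t y) : ℝ) : EReal) := fun t ht => by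
    rw [EReal.coe_add, EReal.coe_toReal ht (hf.ne_bot t)]
  have hlsc : LowerSemicontinuous F := by
    refine hf.lowerSemicontinuous.add' (Continuous.lowerSemicontinuous ?_) fun t => ?_
    · exact continuous_coe_real_ereal.comp (by fun_prop)
    · exact EReal.continuousAt_add (Or.inr (EReal.coe_ne_bot _)) (Or.inr (EReal.coe_ne_top _))
  set r : ℝ := (f t₁).toReal + (‖t₁‖ ^ 2 / 2 - inner ℝ t₁ y)
  -- Beyond this radius the affine minorant plus the quadratic exceeds `r`, the value at `t₁`.
  set R : ℝ := 2 * ‖a - y‖ + 2 + 2 * |r - b|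
  have hout : ∀ t, R < ‖t‖ → (r : EReal) < F t := by
    intro t ht
    refine lt_of_lt_of_le (b := ((inner ℝ t a + b + (‖t‖ ^ 2 / 2 - inner ℝ t y) : ℝ) : EReal)) ?_ ?_
    · rw [EReal.coe_lt_coe_iff]
      have h1 := (abs_le.1 (abs_real_inner_le_norm t (a - y))).1
      rw [inner_sub_right] at h1
      have h2 := le_abs_self (r - b)
      have h3 : 1 + |r - b| ≤ ‖t‖ / 2 - ‖a - y‖ := by simp only [R] at ht; linarith
      have h5 : 1 ≤ ‖t‖ := by
        have := norm_nonneg (a - y); have := abs_nonneg (r - b); simp only [R] at ht; linarith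
      have h4 : 1 + |r - b| ≤ ‖t‖ * (‖t‖ / 2 - ‖a - y‖) := by
        have := abs_nonneg (r - b)
        nlinarith
      nlinarith
    · rw [EReal.coe_add]
      exact add_le_add_left (hab t) _
  obtain ⟨t₀, ht₀, hmin⟩ := LowerSemicontinuousOn.exists_isMinOn
    (s := Metric.closedBall (0 : Eucl n) R)
    ⟨0, by simp only [Metric.mem_closedBall, dist_self, R]; positivity⟩
    (isCompact_closedBall 0 R) (hlsc.lowerSemicontinuousOn _)
  have hr : F t₁ = (r : EReal) := hFcoe t₁ ht₁
  have ht₁R : t₁ ∈ Metric.closedBall (0 : Eucl n) R := by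
    by_contra hn
    rw [mem_closedBall_zero_iff, not_le] at hn
    exact absurd (hout t₁ hn) (by rw [hr]; exact lt_irrefl _)
  have h01 : F t₀ ≤ r := hr ▸ hmin ht₁R
  have hglob : ∀ t, F t₀ ≤ F t := by
    intro t
    by_cases ht : t ∈ Metric.closedBall (0 : Eucl n) R
    · exact hmin ht
    · rw [mem_closedBall_zero_iff, not_le] at ht
      exact h01.trans (hout t ht).le
  have ht₀top : f t₀ ≠ ⊤ := by
    intro htop
    simp only [hF, htop] at h01
    rw [EReal.top_add_coe] at h01
    exact EReal.coe_ne_top _ (top_le_iff.1 h01)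
  refine ⟨t₀, ht₀top, fun s => ?_⟩
  by_cases hs : f s = ⊤
  · rw [hs]; exact le_top
  rw [← EReal.coe_toReal hs (hf.ne_bot s), EReal.coe_le_coe_iff]
  set p := (f t₀).toReal
  set q := (f s).toReal
  have hlam : ∀ l : ℝ, 0 < l → l ≤ 1 →
      0 ≤ (q - p - inner ℝ (s - t₀) (y - t₀)) + l * (‖s - t₀‖ ^ 2 / 2) := by
    intro l hl hl1
    have hm := hf.convex_domain ht₀top hs (sub_nonneg.2 hl1) hl.le (by ring)
    have hc := hf.convexOn_toReal.2 ht₀top hs (sub_nonneg.2 hl1) hl.le (by ring)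
    have hg := hglob ((1 - l) • t₀ + l • s)
    rw [hFcoe _ ht₀top, hFcoe _ hm, EReal.coe_le_coe_iff] at hg
    have he : (1 - l) • t₀ + l • s = t₀ + l • (s - t₀) := by module
    rw [he] at hg hc
    rw [norm_add_sq_real, inner_add_left, norm_smul, real_inner_smul_left, real_inner_smul_right,
      Real.norm_of_nonneg hl.le] at hg
    simp only [smul_eq_mul] at hc
    have : 0 ≤ l * ((q - p - inner ℝ (s - t₀) (y - t₀)) + l * (‖s - t₀‖ ^ 2 / 2)) := by
      rw [inner_sub_right, real_inner_comm t₀ (s - t₀)]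
      simp only [p, q]
      nlinarith
    exact nonneg_of_mul_nonneg_right this hl
  by_contra hX
  push Not at hX
  set X := q - p - inner ℝ (s - t₀) (y - t₀)
  have hX' : X < 0 := by simp only [X]; linarith
  set Y := ‖s - t₀‖ ^ 2 / 2
  have hY : 0 ≤ Y := by positivity
  have hd : 0 < -X + Y + 1 := by linarith
  -- If `X < 0`, this `l` lies in `(0, 1]` and satisfies `l * Y < -X`, contradicting `hlam`.
  have := hlam (-X / (-X + Y + 1)) (div_pos (by linarith) hd) ((div_le_one hd).2 (by linarith))
  rw [div_mul_eq_mul_div] at this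
  have h2 : -X * Y / (-X + Y + 1) < -X := by
    rw [div_lt_iff₀ hd]
    nlinarith
  linarith

end IsAffineSup

namespace IsProx

variable {n : ℕ} {f : Eucl n → EReal} {y t : Eucl n}

theorem legendre_eq (hf : IsAffineSup f) (h : IsProx f y t) :
    legendre (quadAdd f) y = ((inner ℝ t y - (‖t‖ ^ 2 / 2 + (f t).toReal) : ℝ) : EReal) := by
  refine le_antisymm (iSup_le fun s => ?_) ?_
  · by_cases hs : f s = ⊤
    · have : quadAdd f s = ⊤ := by
        by_contra hn
        exact (IsAffineSup.quadAdd_ne_top_iff s).1 hn hs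
      rw [this]
      simp
    · have h2 := h.2 s
      rw [hf.quadAdd_eq_coe hs, ← EReal.coe_sub, EReal.coe_le_coe_iff]
      rw [← EReal.coe_toReal hs (hf.ne_bot s), EReal.coe_le_coe_iff] at h2
      have h3 := sq_nonneg ‖s - t‖
      rw [norm_sub_sq_real] at h3
      rw [inner_sub_right, inner_sub_left, inner_sub_left, real_inner_self_eq_norm_sq] at h2
      linarith
  · have := le_iSup (fun s => ((inner ℝ s y : ℝ) : EReal) - quadAdd f s) t
    rw [hf.quadAdd_eq_coe h.1, ← EReal.coe_sub] at this
    exact this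

/-- Strong monotonicity with an error: adding the subgradient inequality at `t` and the
`δ`-approximate one at `t'` cancels the values of `f`, and the identity part of `y - t` leaves the
square. It controls how far an approximate proximal point is from the exact one. -/
theorem norm_sub_le (hf : IsAffineSup f) (h : IsProx f y t) {y' t' : Eucl n} {δ : ℝ}
    (ht' : f t' ≠ ⊤)
    (h' : ∀ s, (((f t').toReal - δ + inner ℝ (s - t') (y' - t') : ℝ) : EReal) ≤ f s) :
    ‖t' - t‖ ^ 2 ≤ ‖t' - t‖ * ‖y' - y‖ + δ := by
  have h1 := h.2 t'
  have h2 := h' t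
  rw [← EReal.coe_toReal ht' (hf.ne_bot _), EReal.coe_le_coe_iff] at h1
  rw [← EReal.coe_toReal h.1 (hf.ne_bot _), EReal.coe_le_coe_iff] at h2
  have h3 := real_inner_le_norm (t' - t) (y' - y)
  have h4 : inner ℝ (t' - t) (y - t) + inner ℝ (t - t') (y' - t')
      = ‖t' - t‖ ^ 2 - inner ℝ (t' - t) (y' - y) := by
    rw [← real_inner_self_eq_norm_sq, ← neg_sub t' t, inner_neg_left, ← sub_eq_add_neg,
      ← inner_sub_right, ← inner_sub_right]
    congr 1
    abel
  linarith

end IsProx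

namespace IsAffineSup

variable {n : ℕ} {f : Eucl n → EReal}

/-- The first-order remainder lies between `0` (test the supremum at `t`) and a multiple of `|z -
y|²` (the subgradient inequality at `t`, tested at the proximal point of `z`). -/
theorem hasGradientAt_legendre (hf : IsAffineSup f) (h : ∃ t, f t ≠ ⊤) {y t : Eucl n}
    (ht : IsProx f y t) :
    HasGradientAt (fun y => (legendre (quadAdd f) y).toReal) t y := by
  choose P hP using hf.exists_isProx h
  have hval : ∀ z, legendre (quadAdd f) z
      = ((inner ℝ (P z) z - (‖P z‖ ^ 2 / 2 + (f (P z)).toReal) : ℝ) : EReal) :=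
    fun z => (hP z).legendre_eq hf
  have hge : ∀ z s, f s ≠ ⊤ → inner ℝ s z - (‖s‖ ^ 2 / 2 + (f s).toReal)
      ≤ (legendre (quadAdd f) z).toReal := by
    intro z s hs
    have := le_iSup (fun s => ((inner ℝ s z : ℝ) : EReal) - quadAdd f s) s
    rw [hf.quadAdd_eq_coe hs, ← EReal.coe_sub] at this
    change _ ≤ legendre (quadAdd f) z at this
    rw [hval z, EReal.coe_le_coe_iff] at this
    rwa [hval z, EReal.toReal_coe]
  rw [hasGradientAt_iff_isLittleO]
  refine Asymptotics.IsBigO.trans_isLittleO (g := fun z => ‖z - y‖ ^ 2) ?_ ?_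
  · refine Asymptotics.IsBigO.of_bound 1 (Eventually.of_forall fun z => ?_)
    rw [one_mul, Real.norm_eq_abs, Real.norm_eq_abs, abs_of_nonneg (sq_nonneg ‖z - y‖), abs_le]
    have h1 := hge z t ht.1
    have h2 := ht.2 (P z)
    have h3 := congrArg EReal.toReal (ht.legendre_eq hf)
    have h4 := congrArg EReal.toReal (hval z)
    rw [EReal.toReal_coe] at h3 h4
    rw [← EReal.coe_toReal (hP z).1 (hf.ne_bot _), EReal.coe_le_coe_iff] at h2
    have e1 : inner ℝ t (z - y) = inner ℝ t z - inner ℝ t y := inner_sub_right _ _ _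
    constructor
    · nlinarith [sq_nonneg ‖z - y‖]
    · have h5 := real_inner_le_norm (P z - t) (z - y)
      have h6 := norm_sub_sq_real (P z) t
      have e2 : inner ℝ (P z - t) (y - t) + inner ℝ (P z - t) (z - y)
          = inner ℝ (P z) z - inner ℝ t z - inner ℝ (P z) t + ‖t‖ ^ 2 := by
        rw [← inner_add_right, ← real_inner_self_eq_norm_sq]
        simp only [inner_sub_left, inner_sub_right, inner_add_right]
        ring
      nlinarith [sq_nonneg (‖P z - t‖ - ‖z - y‖)]
  · have : (fun z => ‖z - y‖ ^ 2) = (fun z : Eucl n => ‖z‖ ^ 2) ∘ fun z => z - y := rfl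
    rw [this]
    refine ((Asymptotics.isLittleO_norm_pow_id (one_lt_two)).comp_tendsto
      (k := fun z : Eucl n => z - y) (l' := 𝓝 y) ?_)
    have : Tendsto (fun z : Eucl n => z - y) (𝓝 y) (𝓝 (y - y)) :=
      (continuous_id.sub continuous_const).tendsto y
    rwa [sub_self] at this

theorem eDifferentiableAt_legendre (hf : IsAffineSup f) (h : ∃ t, f t ≠ ⊤) (y : Eucl n) :
    EDifferentiableAt (legendre (quadAdd f)) y := by
  refine ⟨Eventually.of_forall fun z => ?_, ?_⟩
  · obtain ⟨t, ht⟩ := hf.exists_isProx h z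
    rw [ht.legendre_eq hf]
    exact ⟨EReal.coe_ne_bot _, EReal.coe_ne_top _⟩
  · obtain ⟨t, ht⟩ := hf.exists_isProx h y
    exact (hf.hasGradientAt_legendre h ht).differentiableAt

theorem isProx_egrad_legendre (hf : IsAffineSup f) (h : ∃ t, f t ≠ ⊤) (y : Eucl n) :
    IsProx f y (egrad (legendre (quadAdd f)) y) := by
  obtain ⟨t, ht⟩ := hf.exists_isProx h y
  rw [egrad, (hf.hasGradientAt_legendre h ht).gradient]
  exact ht

end IsAffineSup

/-! ### Substitutes for compactness. -/

/-- If each of two points of `K m` admits a point of `K m` below the average of their energies by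
their distance, then there are energy minimizing sequences that are Cauchy at any given rate. -/
theorem exists_cauchy_minimizing_seq {X : Type*} (K : ℕ → Set X) (hK : Antitone K)
    (hne : ∀ m, (K m).Nonempty) (J : X → ℝ) {B : ℝ} (hJ0 : ∀ f ∈ K 0, 0 ≤ J f)
    (hJB : ∀ f ∈ K 0, J f ≤ B) (d : X → X → ℝ)
    (hd : ∀ m, ∀ f ∈ K m, ∀ g ∈ K m, ∃ h ∈ K m, J h + d f g ≤ (J f + J g) / 2)
    (η : ℕ → ℝ) (hη : ∀ m, 0 < η m) (hη' : Antitone η) :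
    ∃ f : ℕ → X, (∀ m, f m ∈ K m) ∧ ∀ m p q, m ≤ p → m ≤ q → d (f p) (f q) ≤ η m := by
  set s : ℕ → ℝ := fun m => sInf (J '' K m)
  have hbdd : ∀ m, BddBelow (J '' K m) := fun m => ⟨0, by
    rintro _ ⟨f, hf, rfl⟩
    exact hJ0 f (hK (Nat.zero_le m) hf)⟩
  have hmono : Monotone s := fun p q hpq =>
    csInf_le_csInf (hbdd p) ((hne q).image J) (Set.image_mono (hK hpq))
  have hsB : BddAbove (Set.range s) := by
    refine ⟨B, ?_⟩
    rintro _ ⟨m, rfl⟩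
    obtain ⟨f, hf⟩ := hne m
    exact (csInf_le (hbdd m) ⟨f, hf, rfl⟩).trans (hJB f (hK (Nat.zero_le m) hf))
  set t := ⨆ m, s m
  have hst : Tendsto s atTop (𝓝 t) := tendsto_atTop_ciSup hmono hsB
  have hl : ∀ m, ∃ l, ∀ p ≥ l, t - η m / 2 < s p := fun m =>
    eventually_atTop.1 (hst.eventually_const_lt (by linarith [hη m]))
  choose l hl using hl
  -- Large enough to pass every threshold `l m` with `m ≤ p`, and at least `p`, so that members of
  -- `K (L p)` lie in `K p`.
  set L : ℕ → ℕ := fun p => p + (Finset.range (p + 1)).sup l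
  have hL : ∀ m p, m ≤ p → l m ≤ L p := fun m p hmp =>
    (Finset.le_sup (Finset.mem_range.2 (Nat.lt_succ_of_le hmp))).trans (Nat.le_add_left _ _)
  have hf : ∀ m, ∃ f ∈ K (L m), J f < t + η m / 2 := by
    intro m
    have : s (L m) < t + η m / 2 := by linarith [le_ciSup hsB (L m), hη m]
    obtain ⟨_, ⟨f, hf, rfl⟩, hlt⟩ := exists_lt_of_csInf_lt ((hne _).image J) this
    exact ⟨f, hf, hlt⟩
  choose f hfK hfJ using hf
  refine ⟨f, fun m => hK (Nat.le_add_right _ _) (hfK m), fun m p q hp hq => ?_⟩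
  -- Both energies are below `t + η m / 2`, while `h` has energy above `t - η m / 2`; the gap bounds
  -- the distance.
  obtain ⟨h, hhK, hh⟩ := hd (min (L p) (L q)) (f p) (hK (min_le_left _ _) (hfK p)) (f q)
    (hK (min_le_right _ _) (hfK q))
  have h1 : s (min (L p) (L q)) ≤ J h := csInf_le (hbdd _) ⟨h, hhK, rfl⟩
  have h2 := hl m (min (L p) (L q)) (le_min (hL m p hp) (hL m q hq))
  linarith [hfJ p, hfJ q, hη' hp, hη' hq]

/-- Fatou's lemma for real functions with an integrable lower bound. -/
theorem integrable_and_integral_le_of_tendsto {α : Type*} [MeasurableSpace α] {ν : Measure α}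
    {g : ℕ → α → ℝ} {h w : α → ℝ} {C : ℕ → ℝ} {c : ℝ} (hw : Integrable w ν)
    (hg : ∀ m, Integrable (g m) ν) (hwg : ∀ m, ∀ᵐ x ∂ν, w x ≤ g m x)
    (hC : ∀ m, ∫ x, g m x ∂ν ≤ C m) (hCc : Tendsto C atTop (𝓝 c))
    (hlim : ∀ᵐ x ∂ν, Tendsto (fun m => g m x) atTop (𝓝 (h x))) :
    Integrable h ν ∧ ∫ x, h x ∂ν ≤ c := by
  have hmeas : AEStronglyMeasurable h ν :=
    aestronglyMeasurable_of_tendsto_ae atTop (fun m => (hg m).aestronglyMeasurable) hlim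
  have hwh : ∀ᵐ x ∂ν, w x ≤ h x := by
    filter_upwards [hlim, ae_all_iff.2 hwg] with x hx hx'
    exact ge_of_tendsto' hx hx'
  have hle : ∫⁻ x, ENNReal.ofReal (h x - w x) ∂ν ≤ ENNReal.ofReal (c - ∫ x, w x ∂ν) := by
    calc ∫⁻ x, ENNReal.ofReal (h x - w x) ∂ν
        = ∫⁻ x, liminf (fun m => ENNReal.ofReal (g m x - w x)) atTop ∂ν := by
          refine lintegral_congr_ae ?_
          filter_upwards [hlim] with x hx
          exact ((ENNReal.continuous_ofReal.tendsto _).comp (hx.sub_const _)).liminf_eq.symm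
      _ ≤ liminf (fun m => ∫⁻ x, ENNReal.ofReal (g m x - w x) ∂ν) atTop :=
          lintegral_liminf_le' fun m => ((hg m).sub hw).aestronglyMeasurable.aemeasurable.ennreal_ofReal
      _ ≤ liminf (fun m => ENNReal.ofReal (C m - ∫ x, w x ∂ν)) atTop := by
          refine liminf_le_liminf (Eventually.of_forall fun m => ?_)
          have hi : Integrable (fun x => g m x - w x) ν := (hg m).sub hw
          rw [← ofReal_integral_eq_lintegral_ofReal hi
            ((hwg m).mono fun x hx => by simpa using hx)]
          refine ENNReal.ofReal_le_ofReal ?_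
          rw [integral_sub (hg m) hw]
          linarith [hC m]
      _ = ENNReal.ofReal (c - ∫ x, w x ∂ν) :=
          ((ENNReal.continuous_ofReal.tendsto _).comp (hCc.sub_const _)).liminf_eq
  have hint : Integrable (fun x => h x - w x) ν := by
    refine ⟨hmeas.sub hw.aestronglyMeasurable, ?_⟩
    rw [hasFiniteIntegral_iff_ofReal (hwh.mono fun x hx => by simpa using hx)]
    exact hle.trans_lt ENNReal.ofReal_lt_top
  have hh : Integrable h ν := 
    (hint.add hw).congr (Eventually.of_forall fun x => by simp)
  refine ⟨hh, ?_⟩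
  rw [← ofReal_integral_eq_lintegral_ofReal hint (hwh.mono fun x hx => by simpa using hx),
    integral_sub hh hw] at hle
  have hge : 0 ≤ c - ∫ x, w x ∂ν := by
    refine sub_nonneg.2 (ge_of_tendsto' hCc fun m => ?_)
    exact (integral_mono_ae hw (hg m) (hwg m)).trans (hC m)
  linarith [(ENNReal.ofReal_le_ofReal_iff hge).1 hle]

/-- A limit of the exponentials gives a limit of `g` by taking logarithms, unless that limit is `0`
and `g` tends to `+∞`. Fatou's lemma and the bound on the integrals exclude this almost everywhere.
-/
theorem ae_exists_tendsto_of_exp {α : Type*} [MeasurableSpace α] {ν : Measure α}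
    {g : ℕ → α → ℝ} {c : ℝ} (hg : ∀ m, Integrable (g m) ν) (hg0 : ∀ m, ∀ᵐ x ∂ν, 0 ≤ g m x)
    (hc : ∀ m, ∫ x, g m x ∂ν ≤ c)
    (hlim : ∀ᵐ x ∂ν, ∃ l, Tendsto (fun m => Real.exp (-(g m x) / 2)) atTop (𝓝 l)) :
    ∀ᵐ x ∂ν, ∃ l, Tendsto (fun m => g m x) atTop (𝓝 l) := by
  have hfin : ∫⁻ x, liminf (fun m => ENNReal.ofReal (g m x)) atTop ∂ν ≠ ⊤ := by
    refine ne_top_of_le_ne_top (b := ENNReal.ofReal c) ENNReal.ofReal_ne_top ?_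
    refine (lintegral_liminf_le' fun m =>
      (hg m).aestronglyMeasurable.aemeasurable.ennreal_ofReal).trans ?_
    refine (liminf_le_liminf (Eventually.of_forall fun m => ?_)).trans
      (liminf_const (f := (atTop : Filter ℕ)) (ENNReal.ofReal c)).le
    rw [← ofReal_integral_eq_lintegral_ofReal (hg m) (hg0 m)]
    exact ENNReal.ofReal_le_ofReal (hc m)
  have hmeas : AEMeasurable (fun x => liminf (fun m => ENNReal.ofReal (g m x)) atTop) ν := by
    simp_rw [liminf_eq_iSup_iInf_of_nat]
    exact AEMeasurable.iSup fun _ => AEMeasurable.biInf _ (Set.to_countable _) fun m _ =>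
      (hg m).aestronglyMeasurable.aemeasurable.ennreal_ofReal
  have hae := ae_lt_top' hmeas hfin
  filter_upwards [hlim, hae] with x ⟨l, hl⟩ hx
  have hlog : (fun m => g m x) = fun m => -2 * Real.log (Real.exp (-(g m x) / 2)) := by
    funext m
    rw [Real.log_exp]
    ring
  have hl0 : 0 ≤ l := ge_of_tendsto' hl fun m => (Real.exp_pos _).le
  rcases hl0.eq_or_lt with h0 | hpos
  · exfalso
    rw [← h0] at hl
    have h1 : Tendsto (fun m => Real.exp (-(g m x) / 2)) atTop (𝓝[>] 0) :=
      tendsto_nhdsWithin_iff.2 ⟨hl, Eventually.of_forall fun m => Real.exp_pos _⟩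
    have h2 : Tendsto (fun m => g m x) atTop atTop := by
      rw [hlog]
      exact (Real.tendsto_log_nhdsGT_zero.comp h1).const_mul_atBot_of_neg (by norm_num)
    have h3 := (ENNReal.tendsto_ofReal_atTop.comp h2).liminf_eq
    exact hx.ne h3
  · refine ⟨-2 * Real.log l, ?_⟩
    rw [hlog]
    exact ((Real.continuousAt_log hpos.ne').tendsto.comp hl).const_mul _

/-! ### Transport plans and their marginals. -/

section Plans

variable {n N : ℕ} {μ : Fin N → Measure (Eucl n)} {P : Measure (Fin N → Eucl n)}

theorem measurePreserving_of_mem_plans (hP : P ∈ plans μ) (k : Fin N) :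
    MeasurePreserving (fun x : Fin N → Eucl n => x k) P (μ k) :=
  ⟨measurable_pi_apply k, hP.2 k⟩

theorem integrable_comp_of_mem_plans (hP : P ∈ plans μ) {k : Fin N} {g : Eucl n → ℝ}
    (hg : Integrable g (μ k)) : Integrable (fun x => g (x k)) P :=
  (measurePreserving_of_mem_plans hP k).integrable_comp_of_integrable hg

theorem integral_comp_of_mem_plans (hP : P ∈ plans μ) {k : Fin N} {g : Eucl n → ℝ}
    (hg : Integrable g (μ k)) : ∫ x, g (x k) ∂P = ∫ y, g y ∂μ k := by
  rw [← hP.2 k, integral_map (measurable_pi_apply k).aemeasurable]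
  rw [hP.2 k]
  exact hg.aestronglyMeasurable

theorem ae_comp_of_mem_plans (hP : P ∈ plans μ) {k : Fin N} {p : Eucl n → Prop}
    (hp : ∀ᵐ y ∂μ k, p y) : ∀ᵐ x ∂P, p (x k) :=
  (measurePreserving_of_mem_plans hP k).quasiMeasurePreserving.ae hp

theorem pi_mem_plans (hprob : ∀ k, IsProbabilityMeasure (μ k)) : Measure.pi μ ∈ plans μ :=
  ⟨inferInstance, fun k => (measurePreserving_eval μ k).map_eq⟩

theorem integrable_surplus_of_mem_plans (hmom : ∀ k, Integrable (fun x => ‖x‖ ^ 2) (μ k))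
    (hP : P ∈ plans μ) : Integrable surplus P := by
  refine Integrable.mono' (g := fun x => N * ∑ k, ‖x k‖ ^ 2) ?_
    continuous_surplus.aestronglyMeasurable (Eventually.of_forall abs_surplus_le)
  exact (integrable_finsetSum _ fun k _ => integrable_comp_of_mem_plans hP (hmom k)).const_mul _

end Plans

/-! ### Real-valued admissible potentials. -/

/-- Real-valued admissible potentials: the constraint holds on a product of sets of full
measure. -/
def RealAdmissible {n N : ℕ} (μ : Fin N → Measure (Eucl n)) (f : Fin N → Eucl n → ℝ) : Prop :=
  (∀ k, Integrable (f k) (μ k)) ∧ ∃ D : Fin N → Set (Eucl n), (∀ k, ∀ᵐ x ∂μ k, x ∈ D k) ∧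
    ∀ x : Fin N → Eucl n, (∀ k, x k ∈ D k) → surplus x ≤ ∑ k, f k (x k)

namespace RealAdmissible

variable {n N : ℕ} {μ : Fin N → Measure (Eucl n)} {f g : Fin N → Eucl n → ℝ}

theorem integral_surplus_le (hmom : ∀ k, Integrable (fun x => ‖x‖ ^ 2) (μ k))
    (hf : RealAdmissible μ f) {P : Measure (Fin N → Eucl n)} (hP : P ∈ plans μ) :
    ∫ x, surplus x ∂P ≤ ∑ k, ∫ y, f k y ∂μ k := by
  obtain ⟨hint, D, hD, hle⟩ := hf
  have : ∑ k, ∫ y, f k y ∂μ k = ∫ x, ∑ k, f k (x k) ∂P := by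
    rw [integral_finsetSum _ fun k _ => integrable_comp_of_mem_plans hP (hint k)]
    exact Finset.sum_congr rfl fun k _ => (integral_comp_of_mem_plans hP (hint k)).symm
  rw [this]
  refine integral_mono_ae (integrable_surplus_of_mem_plans hmom hP)
    (integrable_finsetSum _ fun k _ => integrable_comp_of_mem_plans hP (hint k)) ?_
  have := ae_all_iff.2 fun k => ae_comp_of_mem_plans hP (hD k)
  filter_upwards [this] with x hx using hle x hx

/-- Fix `y` in the full-measure set of index `j` and integrate the constraint over the other
variables against the product measure; the surplus is bounded below quadratically. -/
theorem ae_lower_bound (hprob : ∀ k, IsProbabilityMeasure (μ k))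
    (hmom : ∀ k, Integrable (fun x => ‖x‖ ^ 2) (μ k)) (hf : RealAdmissible μ f) (j : Fin N) :
    ∀ᵐ y ∂μ j, -(N * ‖y‖ ^ 2 + N * ∑ k, ∫ x, ‖x‖ ^ 2 ∂μ k
      + ∑ k ∈ Finset.univ.erase j, ∫ x, f k x ∂μ k) ≤ f j y := by
  obtain ⟨hint, D, hD, hle⟩ := hf
  have hP := pi_mem_plans hprob
  filter_upwards [hD j] with y hy
  have hae : ∀ᵐ z ∂Measure.pi μ, -(N * ‖y‖ ^ 2) - N * ∑ k, ‖z k‖ ^ 2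
      ≤ f j y + ∑ k ∈ Finset.univ.erase j, f k (z k) := by
    filter_upwards [ae_all_iff.2 fun k => ae_comp_of_mem_plans hP (hD k)] with z hz
    have h1 := hle (Function.update z j y) fun k => by
      by_cases hk : k = j
      · subst hk; simpa using hy
      · simpa [hk] using hz k
    have h2 := (abs_le.1 (abs_surplus_le (Function.update z j y))).1
    rw [← Finset.add_sum_erase _ _ (Finset.mem_univ j)] at h1 h2
    have e1 : ∑ k ∈ Finset.univ.erase j, f k (Function.update z j y k)
        = ∑ k ∈ Finset.univ.erase j, f k (z k) :=
      Finset.sum_congr rfl fun k hk => by rw [Function.update_of_ne (Finset.ne_of_mem_erase hk)]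
    have e2 : ∑ k ∈ Finset.univ.erase j, ‖Function.update z j y k‖ ^ 2
        = ∑ k ∈ Finset.univ.erase j, ‖z k‖ ^ 2 :=
      Finset.sum_congr rfl fun k hk => by rw [Function.update_of_ne (Finset.ne_of_mem_erase hk)]
    rw [e1, Function.update_self] at h1
    rw [e2, Function.update_self] at h2
    have h3 : ∑ k ∈ Finset.univ.erase j, ‖z k‖ ^ 2 ≤ ∑ k, ‖z k‖ ^ 2 :=
      Finset.sum_le_sum_of_subset_of_nonneg (Finset.subset_univ _) fun _ _ _ => by positivity
    have h4 : (0 : ℝ) ≤ N := Nat.cast_nonneg N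
    nlinarith
  have i1 : Integrable (fun z : Fin N → Eucl n => ∑ k, ‖z k‖ ^ 2) (Measure.pi μ) :=
    integrable_finsetSum _ fun k _ => integrable_comp_of_mem_plans hP (hmom k)
  have i2 : Integrable (fun z : Fin N → Eucl n => ∑ k ∈ Finset.univ.erase j, f k (z k))
      (Measure.pi μ) :=
    integrable_finsetSum _ fun k _ => integrable_comp_of_mem_plans hP (hint k)
  have := integral_mono_ae ((integrable_const _).sub (i1.const_mul _))
    ((integrable_const _).add i2) hae
  rw [integral_sub' (integrable_const _) (i1.const_mul _), integral_const_mul,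
    integral_add' (integrable_const _) i2, integral_const, integral_const,
    integral_finsetSum _ fun k _ => integrable_comp_of_mem_plans hP (hmom k),
    integral_finsetSum _ fun k _ => integrable_comp_of_mem_plans hP (hint k)] at this
  simp only [probReal_univ, smul_eq_mul, one_mul] at this
  rw [Finset.sum_congr rfl fun k _ => integral_comp_of_mem_plans hP (hmom k),
    Finset.sum_congr rfl fun k _ => integral_comp_of_mem_plans hP (hint k)] at this
  linarith

theorem average (hf : RealAdmissible μ f) (hg : RealAdmissible μ g) :
    RealAdmissible μ (fun k x => (f k x + g k x) / 2) := by
  obtain ⟨hfi, D, hD, hfD⟩ := hf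
  obtain ⟨hgi, E, hE, hgE⟩ := hg
  refine ⟨fun k => ((hfi k).add (hgi k)).div_const 2, fun k => D k ∩ E k, fun k => ?_,
    fun x hx => ?_⟩
  · filter_upwards [hD k, hE k] with x h1 h2 using ⟨h1, h2⟩
  · rw [← Finset.sum_div, Finset.sum_add_distrib]
    linarith [hfD x fun k => (hx k).1, hgE x fun k => (hx k).2]

theorem add_const (hprob : ∀ k, IsProbabilityMeasure (μ k)) (hf : RealAdmissible μ f)
    (c : Fin N → ℝ) (hc : 0 ≤ ∑ k, c k) : RealAdmissible μ (fun k x => f k x + c k) := by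
  obtain ⟨hfi, D, hD, hfD⟩ := hf
  refine ⟨fun k => (hfi k).add (integrable_const _), D, hD, fun x hx => ?_⟩
  rw [Finset.sum_add_distrib]
  linarith [hfD x hx]

theorem quadratic (hmom : ∀ k, Integrable (fun x => ‖x‖ ^ 2) (μ k)) :
    RealAdmissible μ (fun _ x => N * ‖x‖ ^ 2) := by
  refine ⟨fun k => (hmom k).const_mul _, fun _ => Set.univ, fun k => by simp, fun x _ => ?_⟩
  rw [← Finset.mul_sum]
  exact (le_abs_self _).trans (abs_surplus_le x)

theorem limit {f : ℕ → Fin N → Eucl n → ℝ} {g : Fin N → Eucl n → ℝ}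
    (hf : ∀ m, RealAdmissible μ (f m)) (hg : ∀ k, Integrable (g k) (μ k))
    (hlim : ∀ k, ∀ᵐ x ∂μ k, Tendsto (fun m => f m k x) atTop (𝓝 (g k x))) :
    RealAdmissible μ g := by
  choose hint D hD hle using hf
  refine ⟨hg, fun k => {x | (∀ m, x ∈ D m k) ∧ Tendsto (fun m => f m k x) atTop (𝓝 (g k x))},
    fun k => ?_, fun x hx => ?_⟩
  · filter_upwards [hlim k, ae_all_iff.2 fun m => hD m k] with x h1 h2 using ⟨h2, h1⟩
  · exact ge_of_tendsto' (tendsto_finsetSum _ fun k _ => (hx k).2)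
      fun m => hle m x fun k => (hx k).1 m

end RealAdmissible

/-! ### Existence of a minimizer by damping. -/

section RealMinimizer

variable {n N : ℕ} {μ : Fin N → Measure (Eucl n)}

/-- The damping `exp (-(f + N|x|² + C) / 2)` of a potential `f`. -/
noncomputable def damped (n N : ℕ) (C : ℝ) (f : Eucl n → ℝ) (x : Eucl n) : ℝ :=
  Real.exp (-(f x + (N * ‖x‖ ^ 2 + C)) / 2)

theorem aestronglyMeasurable_damped {ν : Measure (Eucl n)} (C : ℝ) {f : Eucl n → ℝ}
    (hf : AEStronglyMeasurable f ν) : AEStronglyMeasurable (damped n N C f) ν := by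
  have h : AEStronglyMeasurable (fun x : Eucl n => -(f x + (N * ‖x‖ ^ 2 + C)) / 2) ν := by
    have h2 : Continuous (fun x : Eucl n => (N * ‖x‖ ^ 2 + C : ℝ)) := by fun_prop
    simpa [neg_div, div_eq_mul_inv] using ((hf.add h2.aestronglyMeasurable).neg.mul_const (2⁻¹ : ℝ))
  exact Real.continuous_exp.comp_aestronglyMeasurable h

theorem ae_abs_damped_le {ν : Measure (Eucl n)} {C : ℝ} {f : Eucl n → ℝ}
    (h0 : ∀ᵐ x ∂ν, 0 ≤ f x + (N * ‖x‖ ^ 2 + C)) : ∀ᵐ x ∂ν, |damped n N C f x| ≤ 1 := by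
  filter_upwards [h0] with x hx
  rw [damped, Real.abs_exp]
  exact Real.exp_le_one_iff.2 (by linarith)

theorem memLp_damped {ν : Measure (Eucl n)} [IsFiniteMeasure ν] {C : ℝ} {f : Eucl n → ℝ}
    (hf : AEStronglyMeasurable f ν) (h0 : ∀ᵐ x ∂ν, 0 ≤ f x + (N * ‖x‖ ^ 2 + C)) :
    MemLp (damped n N C f) 2 ν :=
  MemLp.of_bound (aestronglyMeasurable_damped C hf) 1 (ae_abs_damped_le h0)

/-- With `a`, `b` the two dampings, the squared damping of the average is `ab = (a² + b²)/2 - (a -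
b)²/2`. This is the uniform convexity required by `exists_cauchy_minimizing_seq`. -/
theorem integral_damped_average {ν : Measure (Eucl n)} [IsFiniteMeasure ν] {C : ℝ}
    {f g : Eucl n → ℝ} (hf : AEStronglyMeasurable f ν) (hg : AEStronglyMeasurable g ν)
    (hf0 : ∀ᵐ x ∂ν, 0 ≤ f x + (N * ‖x‖ ^ 2 + C)) (hg0 : ∀ᵐ x ∂ν, 0 ≤ g x + (N * ‖x‖ ^ 2 + C)) :
    ∫ x, damped n N C (fun x => (f x + g x) / 2) x ^ 2 ∂ν
      + (∫ x, (damped n N C f x - damped n N C g x) ^ 2 ∂ν) / 2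
      = (∫ x, damped n N C f x ^ 2 ∂ν + ∫ x, damped n N C g x ^ 2 ∂ν) / 2 := by
  have mf := memLp_damped hf hf0
  have mg := memLp_damped hg hg0
  have e : ∀ x, damped n N C (fun x => (f x + g x) / 2) x ^ 2
      = (damped n N C f x ^ 2 + damped n N C g x ^ 2) / 2
        - (damped n N C f x - damped n N C g x) ^ 2 / 2 := by
    intro x
    have : damped n N C (fun x => (f x + g x) / 2) x ^ 2 = damped n N C f x * damped n N C g x := by
      simp only [damped]
      rw [← Real.exp_nat_mul, ← Real.exp_add]
      congr 1
      push_cast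
      ring
    rw [this]
    ring
  have i1 : Integrable (fun x => (damped n N C f x ^ 2 + damped n N C g x ^ 2) / 2) ν :=
    (mf.integrable_sq.add mg.integrable_sq).div_const 2
  have i2 : Integrable (fun x => (damped n N C f x - damped n N C g x) ^ 2 / 2) ν :=
    (mf.sub mg).integrable_sq.div_const 2
  simp_rw [e]
  rw [integral_sub i1 i2, integral_div, integral_div,
    integral_add mf.integrable_sq mg.integrable_sq]
  ring

theorem eLpNorm_one_le_of_integral_sq_le {α : Type*} [MeasurableSpace α] {ν : Measure α}
    [IsProbabilityMeasure ν] {h : α → ℝ} (hh : MemLp h 2 ν) {e : ℝ} (he : 0 < e)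
    (hle : ∫ x, h x ^ 2 ∂ν ≤ e ^ 2) : eLpNorm h 1 ν ≤ ENNReal.ofReal e := by
  have hi : Integrable h ν := hh.integrable one_le_two
  rw [eLpNorm_one_eq_lintegral_enorm, ← ofReal_integral_norm_eq_lintegral_enorm hi]
  refine ENNReal.ofReal_le_ofReal ?_
  have : ∫ x, ‖h x‖ ∂ν ≤ ∫ x, (e + h x ^ 2 / e) / 2 ∂ν := by
    refine integral_mono hi.norm
      (((integrable_const e).add (hh.integrable_sq.div_const e)).div_const 2) fun x => ?_
    simp only
    rw [le_div_iff₀ two_pos, ← sub_nonneg]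
    have : e + h x ^ 2 / e - ‖h x‖ * 2 = (e - ‖h x‖) ^ 2 / e := by
      rw [Real.norm_eq_abs, sub_sq, sq_abs]
      field_simp
      ring
    rw [this]
    positivity
  refine this.trans ?_
  rw [integral_div, integral_add (integrable_const e) (hh.integrable_sq.div_const e),
    integral_const, integral_div, probReal_univ, one_smul]
  have : (∫ x, h x ^ 2 ∂ν) / e ≤ e := by
    rw [div_le_iff₀ he]
    linarith [sq e]
  linarith

/-- Real admissible potentials with `∫ f_k dμ_k = 0` for `k ≠ 1` and value at most `v`. -/
def normalizedSublevel [NeZero N] (μ : Fin N → Measure (Eucl n)) (v : ℝ) :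
    Set (Fin N → Eucl n → ℝ) :=
  {f | RealAdmissible μ f ∧ (∀ k, k ≠ 0 → ∫ x, f k x ∂μ k = 0) ∧ ∫ x, f 0 x ∂μ 0 ≤ v}

variable [NeZero N]

theorem normalizedSublevel_mono {v v' : ℝ} (h : v ≤ v') :
    normalizedSublevel μ v ⊆ normalizedSublevel μ v' :=
  fun _ hf => ⟨hf.1, hf.2.1, hf.2.2.trans h⟩

theorem sum_integral_le_of_mem_normalizedSublevel {v : ℝ} {f : Fin N → Eucl n → ℝ}
    (hf : f ∈ normalizedSublevel μ v) (S : Finset (Fin N)) :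
    ∑ k ∈ S, ∫ x, f k x ∂μ k ≤ |v| := by
  by_cases h0 : (0 : Fin N) ∈ S
  · rw [Finset.sum_eq_single_of_mem 0 h0 fun k _ hk => hf.2.1 k hk]
    exact hf.2.2.trans (le_abs_self v)
  · rw [Finset.sum_eq_zero fun k hk => hf.2.1 k fun h => h0 (h ▸ hk)]
    exact abs_nonneg v

theorem ae_nonneg_of_mem_normalizedSublevel (hprob : ∀ k, IsProbabilityMeasure (μ k))
    (hmom : ∀ k, Integrable (fun x => ‖x‖ ^ 2) (μ k)) {v : ℝ} {f : Fin N → Eucl n → ℝ}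
    (hf : f ∈ normalizedSublevel μ v) (j : Fin N) :
    ∀ᵐ y ∂μ j, 0 ≤ f j y + (N * ‖y‖ ^ 2 + (N * ∑ k, ∫ x, ‖x‖ ^ 2 ∂μ k + |v|)) := by
  filter_upwards [hf.1.ae_lower_bound hprob hmom j] with y hy
  linarith [sum_integral_le_of_mem_normalizedSublevel hf (Finset.univ.erase j)]

theorem average_mem_normalizedSublevel {v : ℝ} {f g : Fin N → Eucl n → ℝ}
    (hf : f ∈ normalizedSublevel μ v) (hg : g ∈ normalizedSublevel μ v) :
    (fun k x => (f k x + g k x) / 2) ∈ normalizedSublevel μ v := by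
  have h : ∀ k, ∫ x, (f k x + g k x) / 2 ∂μ k = (∫ x, f k x ∂μ k + ∫ x, g k x ∂μ k) / 2 :=
    fun k => by rw [integral_div, integral_add (hf.1.1 k) (hg.1.1 k)]
  refine ⟨hf.1.average hg.1, fun k hk => ?_, ?_⟩
  · rw [h, hf.2.1 k hk, hg.2.1 k hk]
    simp
  · rw [h]
    linarith [hf.2.2, hg.2.2]

/-- Adding constants of total sum zero keeps admissibility and the value, and moves the whole value
to the first potential. -/
theorem normalizedSublevel_nonempty (hprob : ∀ k, IsProbabilityMeasure (μ k)) {v : ℝ}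
    {f : Fin N → Eucl n → ℝ} (hf : RealAdmissible μ f) (hv : ∑ k, ∫ x, f k x ∂μ k ≤ v) :
    (normalizedSublevel μ v).Nonempty := by
  set c : Fin N → ℝ := fun k => (if k = 0 then ∑ i, ∫ x, f i x ∂μ i else 0) - ∫ x, f k x ∂μ k
    with hc
  have hsum : ∑ k, c k = 0 := by
    simp only [hc]
    rw [Finset.sum_sub_distrib, Finset.sum_ite_eq' Finset.univ (0 : Fin N)]
    simp
  have h : ∀ k, ∫ x, (f k x + c k) ∂μ k = if k = 0 then ∑ i, ∫ x, f i x ∂μ i else 0 := fun k => by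
    rw [integral_add (hf.1 k) (integrable_const _), integral_const, probReal_univ, one_smul]
    simp only [hc]
    ring
  refine ⟨fun k x => f k x + c k, hf.add_const hprob c hsum.ge, fun k hk => ?_, ?_⟩
  · rw [h, if_neg hk]
  · rw [h, if_pos rfl]
    exact hv

/-- The sequence is chosen to be minimizing for the dual value and, within the shrinking sublevels,
for the damped energy. The latter makes the dampings Cauchy, so the potentials converge almost
everywhere; Fatou's lemma applied to each potential separately keeps the value. -/
theorem exists_realAdmissible_minimizer (hprob : ∀ k, IsProbabilityMeasure (μ k))
    (hmom : ∀ k, Integrable (fun x => ‖x‖ ^ 2) (μ k)) :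
    ∃ f, RealAdmissible μ f ∧ ∀ g, RealAdmissible μ g →
      ∑ k, ∫ x, f k x ∂μ k ≤ ∑ k, ∫ x, g k x ∂μ k := by
  set V : Set ℝ := (fun f : Fin N → Eucl n → ℝ => ∑ k, ∫ x, f k x ∂μ k) '' {f | RealAdmissible μ f}
  have hVne : V.Nonempty := ⟨_, _, RealAdmissible.quadratic hmom, rfl⟩
  have hVb : BddBelow V := by
    refine ⟨∫ x, surplus x ∂Measure.pi μ, ?_⟩
    rintro _ ⟨f, hf, rfl⟩
    exact RealAdmissible.integral_surplus_le hmom hf (pi_mem_plans hprob)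
  set I := sInf V
  set v : ℕ → ℝ := fun m => I + 1 / ((m : ℝ) + 1)
  have hvlim : Tendsto v atTop (𝓝 I) := by
    simpa [v] using (tendsto_one_div_add_atTop_nhds_zero_nat (𝕜 := ℝ)).const_add I
  have hvanti : Antitone v := fun p q hpq => by
    have : (p : ℝ) ≤ q := Nat.cast_le.2 hpq
    simp only [v]
    gcongr
  set K : ℕ → Set (Fin N → Eucl n → ℝ) := fun m => normalizedSublevel μ (v m)
  have hK : Antitone K := fun p q hpq => normalizedSublevel_mono (hvanti hpq)
  have hKne : ∀ m, (K m).Nonempty := by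
    intro m
    have : I < v m := by simp only [v]; linarith [Nat.one_div_pos_of_nat (α := ℝ) (n := m)]
    obtain ⟨_, ⟨f, hf, rfl⟩, hlt⟩ := exists_lt_of_csInf_lt hVne this
    exact normalizedSublevel_nonempty hprob hf hlt.le
  set C : ℝ := N * ∑ k, ∫ x, ‖x‖ ^ 2 ∂μ k + |v 0|
  have h0 : ∀ f ∈ K 0, ∀ j, ∀ᵐ y ∂μ j, 0 ≤ f j y + (N * ‖y‖ ^ 2 + C) :=
    fun f hf j => ae_nonneg_of_mem_normalizedSublevel hprob hmom hf j
  have hK0 : ∀ m, K m ⊆ K 0 := fun m => hK (Nat.zero_le m)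
  set J : (Fin N → Eucl n → ℝ) → ℝ := fun f => ∑ k, ∫ x, damped n N C (f k) x ^ 2 ∂μ k
  set d : (Fin N → Eucl n → ℝ) → (Fin N → Eucl n → ℝ) → ℝ := fun f g =>
    ∑ k, (∫ x, (damped n N C (f k) x - damped n N C (g k) x) ^ 2 ∂μ k) / 2
  obtain ⟨f, hfK, hfd⟩ := exists_cauchy_minimizing_seq K hK hKne J (B := N)
    (fun f _ => Finset.sum_nonneg fun k _ => integral_nonneg fun x => sq_nonneg _)
    (fun f hf => by
      have : ∀ k ∈ Finset.univ, ∫ x, damped n N C (f k) x ^ 2 ∂μ k ≤ 1 := fun k _ => by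
        have h1 : ∫ x, damped n N C (f k) x ^ 2 ∂μ k ≤ ∫ _, (1 : ℝ) ∂μ k := by
          refine integral_mono_ae
            (memLp_damped (hf.1.1 k).aestronglyMeasurable (h0 f hf k)).integrable_sq
            (integrable_const _) ?_
          filter_upwards [ae_abs_damped_le (h0 f hf k)] with x hx
          exact (sq_le_one_iff_abs_le_one _).2 hx
        simpa using h1
      simpa using Finset.sum_le_card_nsmul _ _ 1 this) d
    (fun m f hf g hg => ⟨_, average_mem_normalizedSublevel hf hg, by
      simp only [J, d]
      rw [← Finset.sum_add_distrib, ← Finset.sum_add_distrib, Finset.sum_div]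
      exact (Finset.sum_congr rfl fun k _ => integral_damped_average
        (hf.1.1 k).aestronglyMeasurable (hg.1.1 k).aestronglyMeasurable
        (h0 f (hK0 m hf) k) (h0 g (hK0 m hg) k)).le⟩)
    -- With this rate the squared L² distances are at most `(1/4)^m`, hence the L¹ distances at most
    -- `(1/2)^m`, which is summable.
    (fun m => (1 / 4) ^ m / 2) (fun m => by positivity)
    (fun p q hpq => div_le_div_of_nonneg_right
      (pow_le_pow_of_le_one (by norm_num) (by norm_num) hpq) two_pos.le)
  have hexp : ∀ k, ∀ᵐ x ∂μ k, ∃ l, Tendsto (fun m => damped n N C (f m k) x) atTop (𝓝 l) := by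
    intro k
    have hmem : ∀ m, MemLp (damped n N C (f m k)) 2 (μ k) := fun m =>
      memLp_damped ((hfK m).1.1 k).aestronglyMeasurable (h0 _ (hK0 m (hfK m)) k)
    refine Lp.ae_tendsto_of_cauchy_eLpNorm (p := 1) (fun m => (hmem m).aestronglyMeasurable) le_rfl
      (B := fun m => ENNReal.ofReal (2 * (1 / 2) ^ m)) ?_ fun M p q hp hq => ?_
    -- The factor `2` supplies the strict inequality demanded of the Cauchy bound.
    · exact ((summable_geometric_two).mul_left 2).tsum_ofReal_ne_top
    · refine (eLpNorm_one_le_of_integral_sq_le ((hmem p).sub (hmem q))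
        (e := (1 / 2) ^ M) (by positivity) ?_).trans_lt ?_
      · have h1 := hfd M p q hp hq
        have h2 := Finset.single_le_sum (f := fun k =>
          (∫ x, (damped n N C (f p k) x - damped n N C (f q k) x) ^ 2 ∂μ k) / 2)
          (fun i _ => by positivity) (Finset.mem_univ k)
        have h3 : ((1 / 2 : ℝ) ^ M) ^ 2 = (1 / 4) ^ M := by
          rw [← pow_mul, mul_comm, pow_mul]
          norm_num
        simp only [Pi.sub_apply]
        rw [h3]
        simp only [d] at h1
        linarith
      · refine (ENNReal.ofReal_lt_ofReal_iff (by positivity)).2 ?_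
        have : (0 : ℝ) < (1 / 2) ^ M := by positivity
        linarith
  have hq : ∀ k, Integrable (fun x => (N * ‖x‖ ^ 2 + C : ℝ)) (μ k) := fun k =>
    ((hmom k).const_mul _).add (integrable_const _)
  have hlim : ∀ k, ∀ᵐ x ∂μ k, Tendsto (fun m => f m k x) atTop
      (𝓝 (limUnder atTop fun m => f m k x)) := by
    intro k
    have := ae_exists_tendsto_of_exp (g := fun m x => f m k x + (N * ‖x‖ ^ 2 + C))
      (c := |v 0| + ∫ x, (N * ‖x‖ ^ 2 + C : ℝ) ∂μ k)
      (fun m => ((hfK m).1.1 k).add (hq k)) (fun m => h0 _ (hK0 m (hfK m)) k)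
      (fun m => by
        rw [integral_add ((hfK m).1.1 k) (hq k)]
        have := sum_integral_le_of_mem_normalizedSublevel (hK0 m (hfK m)) {k}
        rw [Finset.sum_singleton] at this
        linarith) (hexp k)
    filter_upwards [this] with x ⟨l, hl⟩
    refine tendsto_nhds_limUnder ⟨l - (N * ‖x‖ ^ 2 + C), ?_⟩
    exact (hl.sub_const (N * ‖x‖ ^ 2 + C)).congr fun m => add_sub_cancel_right _ _
  -- The normalization fixes the limit bound of each integral separately: `I` for the first index
  -- and `0` for the others, with sum `I`.
  have hfatou : ∀ k, Integrable (fun x => limUnder atTop fun m => f m k x) (μ k) ∧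
      ∫ x, (limUnder atTop fun m => f m k x) ∂μ k ≤ if k = 0 then I else 0 := fun k =>
    integrable_and_integral_le_of_tendsto (C := fun m => if k = 0 then v m else 0) (hq k).neg
      (fun m => (hfK m).1.1 k)
      (fun m => (h0 _ (hK0 m (hfK m)) k).mono fun x hx => by
        simp only [Pi.neg_apply]; linarith)
      (fun m => by
        split_ifs with h
        · subst h; exact (hfK m).2.2
        · exact ((hfK m).2.1 k h).le)
      (by
        split_ifs
        · exact hvlim
        · exact tendsto_const_nhds) (hlim k)
  refine ⟨fun k x => limUnder atTop fun m => f m k x,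
    RealAdmissible.limit (fun m => (hfK m).1) (fun k => (hfatou k).1) hlim, fun g hg => ?_⟩
  refine le_trans ?_ (csInf_le hVb ⟨g, hg, rfl⟩)
  refine (Finset.sum_le_sum fun k _ => (hfatou k).2).trans ?_
  simp [I]

end RealMinimizer

/-! ### Conjugation and conjugate dual solutions. -/

/-- The conjugate
`sup { c(x₁, …, x_N) - ∑_{k ≠ j} φ_k(x_k) : x_j = y, x_k ∈ Spt μ_k for k ≠ j }`. -/
noncomputable def surplusConj {n N : ℕ} (μ : Fin N → Measure (Eucl n))
    (φ : Fin N → Eucl n → EReal) (j : Fin N) (y : Eucl n) : EReal :=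
  ⨆ (x : Fin N → Eucl n) (_ : x j = y) (_ : ∀ k, k ≠ j → x k ∈ (μ k).support),
    ((surplus x : EReal) - ∑ k ∈ Finset.univ.erase j, φ k (x k))

/-- Tuples at which some potential is `⊤` contribute `⊥` and can be dropped; the others contribute
real affine functions of `t`. -/
theorem IsAffineSup.of_iSup_sub {n N : ℕ} {φ : Fin N → Eucl n → EReal}
    (hφ : ∀ k x, φ k x ≠ ⊥) {s : Finset (Fin N)} {A : Set (Fin N → Eucl n)}
    (hA : ∃ x ∈ A, ∀ k ∈ s, φ k (x k) ≠ ⊤) (a : (Fin N → Eucl n) → Eucl n)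
    (b : (Fin N → Eucl n) → ℝ) {f : Eucl n → EReal}
    (hf : ∀ t, f t = ⨆ x ∈ A, (((inner ℝ t (a x) + b x : ℝ) : EReal) - ∑ k ∈ s, φ k (x k))) :
    IsAffineSup f := by
  refine ⟨(fun x => (a x, b x - ∑ k ∈ s, (φ k (x k)).toReal)) ''
    {x | x ∈ A ∧ ∀ k ∈ s, φ k (x k) ≠ ⊤}, Set.Nonempty.image _ hA, fun t => ?_⟩
  rw [hf t, iSup_image]
  have key : ∀ x, (∀ k ∈ s, φ k (x k) ≠ ⊤) →
      ((inner ℝ t (a x) + b x : ℝ) : EReal) - ∑ k ∈ s, φ k (x k)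
      = ((inner ℝ t (a x) + (b x - ∑ k ∈ s, (φ k (x k)).toReal) : ℝ) : EReal) := by
    intro x hx
    rw [EReal.sum_eq_coe_sum_toReal (fun k _ => hφ k _) hx, ← EReal.coe_sub, add_sub_assoc]
  refine le_antisymm (iSup₂_le fun x hx => ?_) (iSup₂_le fun x hx => ?_)
  · by_cases h : ∀ k ∈ s, φ k (x k) ≠ ⊤
    · rw [key x h]
      exact le_iSup₂ (f := fun x (_ : x ∈ {x | x ∈ A ∧ ∀ k ∈ s, φ k (x k) ≠ ⊤}) =>
        ((inner ℝ t (a x) + (b x - ∑ k ∈ s, (φ k (x k)).toReal) : ℝ) : EReal)) x ⟨hx, h⟩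
    · push Not at h
      obtain ⟨k, hk, hkt⟩ := h
      rw [EReal.sum_eq_top (fun k _ => hφ k _) hk hkt, EReal.sub_top]
      exact bot_le
  · rw [← key x hx.2]
    exact le_iSup₂ (f := fun x (_ : x ∈ A) =>
      (((inner ℝ t (a x) + b x : ℝ) : EReal) - ∑ k ∈ s, φ k (x k))) x hx.1

section Conjugation

variable {n N : ℕ} {μ : Fin N → Measure (Eucl n)} {φ : Fin N → Eucl n → EReal}

theorem IsConjugateTuple.eq_surplusConj (hc : IsConjugateTuple μ φ) (j : Fin N) (y : Eucl n) :
    φ j y = surplusConj μ φ j y := hc j y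

theorem le_surplusConj (φ : Fin N → Eucl n → EReal) {j : Fin N} {x : Fin N → Eucl n}
    (hx : ∀ k, k ≠ j → x k ∈ (μ k).support) :
    (surplus x : EReal) - ∑ k ∈ Finset.univ.erase j, φ k (x k) ≤ surplusConj μ φ j (x j) :=
  le_iSup_of_le x (le_iSup₂_of_le rfl hx le_rfl)

theorem surplusConj_le_iff {j : Fin N} {y : Eucl n} {r : EReal} :
    surplusConj μ φ j y ≤ r ↔ ∀ x : Fin N → Eucl n, x j = y →
      (∀ k, k ≠ j → x k ∈ (μ k).support) →
      (surplus x : EReal) - ∑ k ∈ Finset.univ.erase j, φ k (x k) ≤ r := by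
  simp only [surplusConj, iSup_le_iff]

theorem surplusConj_mono {φ' : Fin N → Eucl n → EReal} {j : Fin N} (y : Eucl n)
    (h : ∀ k, k ≠ j → ∀ x ∈ (μ k).support, φ' k x ≤ φ k x) :
    surplusConj μ φ j y ≤ surplusConj μ φ' j y := by
  rw [surplusConj_le_iff]
  rintro x rfl hx
  refine le_trans ?_ (le_surplusConj φ' hx)
  exact EReal.sub_le_sub le_rfl (Finset.sum_le_sum fun k hk =>
    h k (Finset.ne_of_mem_erase hk) _ (hx k (Finset.ne_of_mem_erase hk)))

namespace IsDualAdmissible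

theorem exists_mem_support (hprob : ∀ k, IsProbabilityMeasure (μ k))
    (h : IsDualAdmissible μ φ) : ∃ x : Fin N → Eucl n, ∀ k, x k ∈ (μ k).support ∧ φ k (x k) ≠ ⊤ := by
  have : ∀ k, ∃ x, x ∈ (μ k).support ∧ φ k x ≠ ⊤ := fun k => by
    have h1 : ∀ᵐ x ∂μ k, x ∈ (μ k).support := Measure.support_mem_ae
    exact (h1.and (h.ae_ne_top k)).exists
  choose x hx using this
  exact ⟨x, hx⟩

theorem isAffineSup_surplusConj (hprob : ∀ k, IsProbabilityMeasure (μ k))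
    (h : IsDualAdmissible μ φ) (j : Fin N) : IsAffineSup (surplusConj μ φ j) := by
  obtain ⟨x₀, hx₀⟩ := h.exists_mem_support hprob
  refine IsAffineSup.of_iSup_sub h.ne_bot (s := Finset.univ.erase j)
    (A := {x | ∀ k, k ≠ j → x k ∈ (μ k).support})
    ⟨x₀, fun k _ => (hx₀ k).1, fun k _ => (hx₀ k).2⟩
    (fun x => ∑ k ∈ Finset.univ.erase j, x k) (pairSum (Finset.univ.erase j)) fun t => ?_
  refine le_antisymm ?_ (iSup₂_le fun x hx => ?_)
  · rw [surplusConj_le_iff]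
    rintro x rfl hx
    rw [surplus_eq_inner_add x j]
    exact le_iSup₂ (f := fun x' (_ : x' ∈ {x | ∀ k, k ≠ j → x k ∈ (μ k).support}) =>
      ((inner ℝ (x j) (∑ k ∈ Finset.univ.erase j, x' k) + pairSum (Finset.univ.erase j) x' : ℝ) :
        EReal) - ∑ k ∈ Finset.univ.erase j, φ k (x' k)) x hx
  · have hu : ∀ k ∈ Finset.univ.erase j, Function.update x j t k = x k := fun k hk =>
      Function.update_of_ne (Finset.ne_of_mem_erase hk) _ _
    have := le_surplusConj (μ := μ) φ (j := j) (x := Function.update x j t) fun k hk => by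
      rw [Function.update_of_ne hk]
      exact hx k hk
    rw [surplus_eq_inner_add _ j, Finset.sum_congr rfl hu, pairSum_congr hu,
      Finset.sum_congr rfl fun k hk => congrArg (φ k) (hu k hk), Function.update_self] at this
    exact this

theorem surplusConj_le (h : IsDualAdmissible μ φ) {j : Fin N} {y : Eucl n}
    (hy : y ∈ (μ j).support) : surplusConj μ φ j y ≤ φ j y := by
  rw [surplusConj_le_iff]
  rintro x rfl hx
  refine EReal.sub_le_of_le_add ?_
  rw [Finset.add_sum_erase _ (fun k => φ k (x k)) (Finset.mem_univ j)]
  refine h.le_sum x fun k => ?_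
  by_cases hk : k = j
  · subst hk; exact hy
  · exact hx k hk

theorem realAdmissible (h : IsDualAdmissible μ φ) :
    RealAdmissible μ (fun k x => (φ k x).toReal) := by
  refine ⟨h.integrable, fun k => {x | x ∈ (μ k).support ∧ φ k x ≠ ⊤}, fun k => ?_, fun x hx => ?_⟩
  · have h1 : ∀ᵐ x ∂μ k, x ∈ (μ k).support := Measure.support_mem_ae
    exact h1.and (h.ae_ne_top k)
  · have := h.le_sum x fun k => (hx k).1
    rwa [EReal.sum_eq_coe_sum_toReal (fun k _ => h.ne_bot k _) fun k _ => (hx k).2,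
      EReal.coe_le_coe_iff] at this

/-- Potentials remain admissible when `φ_j` is replaced by the conjugate of the others. -/
theorem update (hprob : ∀ k, IsProbabilityMeasure (μ k))
    (hmom : ∀ k, Integrable (fun x => ‖x‖ ^ 2) (μ k)) (h : IsDualAdmissible μ φ) (j : Fin N) :
    IsDualAdmissible μ (Function.update φ j (surplusConj μ φ j)) := by
  have hS := h.isAffineSup_surplusConj hprob j
  have hsupp : ∀ᵐ x ∂μ j, x ∈ (μ j).support := Measure.support_mem_ae
  have hle : ∀ᵐ x ∂μ j, surplusConj μ φ j x ≤ φ j x := hsupp.mono fun x hx => h.surplusConj_le hx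
  have htop : ∀ᵐ x ∂μ j, surplusConj μ φ j x ≠ ⊤ := by
    filter_upwards [hle, h.ae_ne_top j] with x h1 h2 h3
    exact h2 (top_le_iff.1 (h3 ▸ h1))
  refine ⟨fun k x => ?_, fun k => ?_, fun k => ?_, fun x hx => ?_⟩
  · by_cases hk : k = j
    · subst hk; rw [Function.update_self]; exact hS.ne_bot x
    · rw [Function.update_of_ne hk]; exact h.ne_bot k x
  · by_cases hk : k = j
    · subst hk; rwa [Function.update_self]
    · rw [Function.update_of_ne hk]; exact h.ae_ne_top k
  · by_cases hk : k = j
    · subst hk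
      rw [Function.update_self]
      obtain ⟨a, b, hab⟩ := hS.exists_affine_le
      -- The conjugate lies between an affine minorant and `φ_k` almost everywhere; this function
      -- dominates both, using `‖x‖ ≤ 1 + ‖x‖²`.
      have hi : Integrable (fun x => (1 + ‖x‖ ^ 2) * ‖a‖ + |b| + |(φ k x).toReal|) (μ k) :=
        ((((integrable_const _).add (hmom k)).mul_const _).add (integrable_const _)).add
          (h.integrable k).abs
      refine hi.mono' hS.measurable.ereal_toReal.aestronglyMeasurable ?_
      filter_upwards [hle, htop, h.ae_ne_top k] with x h1 h2 h3
      have h4 := hab x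
      rw [← EReal.coe_toReal h2 (hS.ne_bot x), EReal.coe_le_coe_iff] at h4
      rw [← EReal.coe_toReal h2 (hS.ne_bot x), ← EReal.coe_toReal h3 (h.ne_bot k x),
        EReal.coe_le_coe_iff] at h1
      have h5 := (abs_le.1 (abs_real_inner_le_norm x a)).1
      have h6 : ‖x‖ * ‖a‖ ≤ (1 + ‖x‖ ^ 2) * ‖a‖ :=
        mul_le_mul_of_nonneg_right (by nlinarith [sq_nonneg (‖x‖ - 1)]) (norm_nonneg a)
      have h7 := neg_abs_le b
      have h8 := abs_nonneg b
      have h9 := abs_nonneg (φ k x).toReal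
      have h10 := le_abs_self (φ k x).toReal
      have h11 : 0 ≤ (1 + ‖x‖ ^ 2) * ‖a‖ := by positivity
      rw [Real.norm_eq_abs, abs_le]
      constructor <;> linarith
    · rw [Function.update_of_ne hk]; exact h.integrable k
  · rw [← Finset.add_sum_erase _ _ (Finset.mem_univ j), Function.update_self,
      Finset.sum_congr rfl fun k hk => by rw [Function.update_of_ne (Finset.ne_of_mem_erase hk)]]
    by_cases ht : ∀ k ∈ Finset.univ.erase j, φ k (x k) ≠ ⊤
    · have := le_surplusConj φ (j := j) fun k _ => hx k
      rw [EReal.sum_eq_coe_sum_toReal (fun k _ => h.ne_bot k _) ht] at this ⊢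
      exact (EReal.sub_le_iff_le_add (Or.inl (EReal.coe_ne_bot _))
        (Or.inl (EReal.coe_ne_top _))).1 this
    · push Not at ht
      obtain ⟨k, hk, hkt⟩ := ht
      rw [EReal.sum_eq_top (fun k _ => h.ne_bot k _) hk hkt,
        EReal.add_top_of_ne_bot (hS.ne_bot _)]
      exact le_top

end IsDualAdmissible

theorem IsConjugateTuple.isAffineSup (hprob : ∀ k, IsProbabilityMeasure (μ k))
    (h : IsDualAdmissible μ φ) (hc : IsConjugateTuple μ φ) (j : Fin N) : IsAffineSup (φ j) := by
  have : φ j = surplusConj μ φ j := funext (hc j)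
  rw [this]
  exact h.isAffineSup_surplusConj hprob j

/-- Giving the real minimizer the value `⊤` off its full-measure sets makes the constraint hold
everywhere without changing the integrals. -/
theorem exists_isDualSolution [NeZero N] (hprob : ∀ k, IsProbabilityMeasure (μ k))
    (hmom : ∀ k, Integrable (fun x => ‖x‖ ^ 2) (μ k)) : ∃ φ, IsDualSolution μ φ := by
  classical
  obtain ⟨f, hf, hmin⟩ := exists_realAdmissible_minimizer hprob hmom
  obtain ⟨hint, D, hD, hle⟩ := hf
  set φ : Fin N → Eucl n → EReal := fun k x => if x ∈ D k then (f k x : EReal) else ⊤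
  have hφf : ∀ k, (fun x => (φ k x).toReal) =ᵐ[μ k] f k := fun k => by
    filter_upwards [hD k] with x hx
    simp [φ, hx]
  have hbot : ∀ k x, φ k x ≠ ⊥ := fun k x => by
    simp only [φ]
    split_ifs <;> simp
  refine ⟨φ, ⟨hbot, fun k => ?_, fun k => (hint k).congr (hφf k).symm, fun x _ => ?_⟩,
    fun χ hχ => ?_⟩
  · filter_upwards [hD k] with x hx
    simp [φ, hx]
  · by_cases hx : ∀ k, x k ∈ D k
    · rw [EReal.sum_eq_coe_sum_toReal (fun k _ => hbot k _) fun k _ => by simp [φ, hx k],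
        EReal.coe_le_coe_iff]
      simpa [φ, hx] using hle x hx
    · push Not at hx
      obtain ⟨k, hk⟩ := hx
      rw [EReal.sum_eq_top (fun k _ => hbot k _) (Finset.mem_univ k) (by simp [φ, hk])]
      exact le_top
  · rw [Finset.sum_congr rfl fun k _ => integral_congr_ae (hφf k)]
    exact hmin _ hχ.realAdmissible

theorem IsDualSolution.update (hprob : ∀ k, IsProbabilityMeasure (μ k))
    (hmom : ∀ k, Integrable (fun x => ‖x‖ ^ 2) (μ k)) (h : IsDualSolution μ φ) (j : Fin N) :
    IsDualSolution μ (Function.update φ j (surplusConj μ φ j)) := by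
  have hu := h.1.update hprob hmom j
  refine ⟨hu, fun χ hχ => le_trans (Finset.sum_le_sum fun k _ => ?_) (h.2 χ hχ)⟩
  refine integral_mono_ae (hu.integrable k) (h.1.integrable k) ?_
  by_cases hk : k = j
  · subst hk
    have hsupp : ∀ᵐ x ∂μ k, x ∈ (μ k).support := Measure.support_mem_ae
    filter_upwards [hsupp, h.1.ae_ne_top k] with x hx hx'
    have := h.1.surplusConj_le hx
    simp only [Function.update_self]
    exact EReal.toReal_le_toReal this ((h.1.isAffineSup_surplusConj hprob k).ne_bot x) hx'
  · simp only [Function.update_of_ne hk]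
    exact Eventually.of_forall fun _ => le_rfl

theorem IsDualSolution.congr (h : IsDualSolution μ φ) {φ' : Fin N → Eucl n → EReal}
    (hbot : ∀ k x, φ' k x ≠ ⊥) (heq : ∀ k, ∀ x ∈ (μ k).support, φ' k x = φ k x) :
    IsDualSolution μ φ' := by
  have hae : ∀ k, φ' k =ᵐ[μ k] φ k := fun k => by
    have hsupp : ∀ᵐ x ∂μ k, x ∈ (μ k).support := Measure.support_mem_ae
    exact hsupp.mono fun x hx => heq k x hx
  have hae' : ∀ k, (fun x => (φ' k x).toReal) =ᵐ[μ k] fun x => (φ k x).toReal := fun k =>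
    (hae k).fun_comp EReal.toReal
  refine ⟨⟨hbot, fun k => ?_, fun k => (h.1.integrable k).congr (hae' k).symm, fun x hx => ?_⟩,
    fun χ hχ => ?_⟩
  · filter_upwards [hae k, h.1.ae_ne_top k] with x h1 h2
    rwa [h1]
  · rw [Finset.sum_congr rfl fun k _ => heq k (x k) (hx k)]
    exact h.1.le_sum x hx
  · rw [Finset.sum_congr rfl fun k _ => integral_congr_ae (hae' k)]
    exact h.2 χ hχ

/-- Replacing `φ_j` by its conjugate lowers it on the support, which only raises the other
conjugates. Hence the inequalities `φ_k ≤ surplusConj μ φ k` obtained for earlier indices survive,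
and at the end equality holds on all supports. -/
theorem exists_conjugate_isDualSolution [NeZero N] (hprob : ∀ k, IsProbabilityMeasure (μ k))
    (hmom : ∀ k, Integrable (fun x => ‖x‖ ^ 2) (μ k)) :
    ∃ φ, IsDualSolution μ φ ∧ IsConjugateTuple μ φ := by
  have hind : ∀ S : Finset (Fin N), ∃ φ, IsDualSolution μ φ ∧
      ∀ k ∈ S, ∀ x ∈ (μ k).support, φ k x ≤ surplusConj μ φ k x := by
    intro S
    induction S using Finset.induction_on with
    | empty =>
      obtain ⟨φ, hφ⟩ := exists_isDualSolution hprob hmom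
      exact ⟨φ, hφ, by simp⟩
    | insert j S hj ih =>
      obtain ⟨φ, hφ, hS⟩ := ih
      have hle : ∀ k, ∀ x ∈ (μ k).support,
          Function.update φ j (surplusConj μ φ j) k x ≤ φ k x := by
        intro k x hx
        by_cases hk : k = j
        · subst hk
          rw [Function.update_self]
          exact hφ.1.surplusConj_le hx
        · rw [Function.update_of_ne hk]
      refine ⟨_, hφ.update hprob hmom j, fun k hk x hx => ?_⟩
      refine le_trans ?_ (surplusConj_mono x fun i _ => hle i)
      rcases Finset.mem_insert.1 hk with rfl | hk
      · rw [Function.update_self]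
      · rw [Function.update_of_ne fun h : k = j => hj (h ▸ hk)]
        exact hS k hk x hx
  obtain ⟨φ, hφ, hS⟩ := hind Finset.univ
  have heq : ∀ k, ∀ x ∈ (μ k).support, surplusConj μ φ k x = φ k x := fun k x hx =>
    le_antisymm (hφ.1.surplusConj_le hx) (hS k (Finset.mem_univ k) x hx)
  -- Off the supports `φ` may differ from its conjugates. Conjugates read only values on the
  -- supports, so conjugating all indices at once gives a tuple that is conjugate everywhere.
  refine ⟨surplusConj μ φ,
    hφ.congr (fun k => (hφ.1.isAffineSup_surplusConj hprob k).ne_bot) heq, fun j y => ?_⟩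
  exact le_antisymm (surplusConj_mono y fun k _ x hx => (heq k x hx).le)
    (surplusConj_mono y fun k _ x hx => (heq k x hx).ge)

end Conjugation

/-! ### Approximate subgradients and lower limits of sums. -/

theorem EDifferentiableAt.exists_norm_sub_egrad_le {n : ℕ} {f : Eucl n → EReal} {x₀ : Eucl n}
    (hf : EDifferentiableAt f x₀) {η : ℝ} (hη : 0 < η) :
    ∃ δ > 0, ∀ p : Eucl n,
      (∀ y, (((f x₀).toReal - δ + inner ℝ (y - x₀) p : ℝ) : EReal) ≤ f y) →
      ‖p - egrad f x₀‖ ≤ η := by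
  obtain ⟨hfin, hd⟩ := hf
  have hg := hasGradientAt_iff_isLittleO.1 hd.hasGradientAt
  have h1 := (hg.def (half_pos hη)).and hfin
  obtain ⟨r, hr, hball⟩ := Metric.nhds_basis_closedBall.mem_iff.1 h1
  -- The test point is at distance `r` in the direction of `p - Df(x₀)`; there the linearization
  -- error is also at most `r * (η / 2)`, so the two errors add up to `r * η`.
  refine ⟨r * (η / 2), by positivity, fun p hp => ?_⟩
  set q := p - egrad f x₀ with hq
  by_cases hq0 : q = 0
  · rw [hq0, norm_zero]; exact hη.le
  have hqpos : 0 < ‖q‖ := norm_pos_iff.2 hq0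
  set v := (r / ‖q‖) • q with hv
  have hvn : ‖v‖ = r := by
    rw [hv, norm_smul, Real.norm_of_nonneg (by positivity)]
    field_simp
  obtain ⟨h2, h3, h4⟩ := hball (show x₀ + v ∈ Metric.closedBall x₀ r by
    rw [mem_closedBall_iff_norm, add_sub_cancel_left, hvn])
  have h5 := hp (x₀ + v)
  rw [← EReal.coe_toReal h4 h3, EReal.coe_le_coe_iff] at h5
  rw [add_sub_cancel_left] at h2 h5
  rw [hvn, Real.norm_eq_abs] at h2
  have h6 := (abs_le.1 h2).2
  have h7 : inner ℝ v q = r * ‖q‖ := by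
    rw [hv, real_inner_smul_left, real_inner_self_eq_norm_sq]
    field_simp
  have h8 : inner ℝ v q = inner ℝ v p - inner ℝ v (egrad f x₀) := by rw [hq, inner_sub_right]
  have h9 : inner ℝ v (egrad f x₀) = inner ℝ (gradient (fun y => (f y).toReal) x₀) v :=
    real_inner_comm _ _
  have h10 : r * ‖q‖ ≤ r * η := by linarith
  exact le_of_mul_le_mul_left h10 hr

/-- This allows lower semicontinuity to be used one summand at a time. Finiteness comes for free,
since an infinite summand would permit arbitrarily large `a`. -/
theorem EReal.sum_le_of_forall_lt {ι : Type*} (s : Finset ι) {f : ι → EReal} {r : ℝ}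
    (hf : ∀ k ∈ s, f k ≠ ⊥)
    (h : ∀ a : ι → ℝ, (∀ k ∈ s, (a k : EReal) < f k) → ∑ k ∈ s, a k ≤ r) :
    (∀ k ∈ s, f k ≠ ⊤) ∧ ∑ k ∈ s, (f k).toReal ≤ r := by
  classical
  have hb : ∀ k, ∃ b : ℝ, k ∈ s → (b : EReal) < f k := fun k => by
    by_cases hk : k ∈ s
    · obtain ⟨b, -, hb⟩ := EReal.lt_iff_exists_real_btwn.1 (bot_lt_iff_ne_bot.2 (hf k hk))
      exact ⟨b, fun _ => hb⟩
    · exact ⟨0, fun h => absurd h hk⟩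
  choose b hb using hb
  have htop : ∀ k ∈ s, f k ≠ ⊤ := by
    intro j hj hjt
    have := h (Function.update b j (r - ∑ k ∈ s.erase j, b k + 1)) fun k hk => by
      by_cases hkj : k = j
      · subst hkj
        rw [hjt]
        exact EReal.coe_lt_top _
      · rw [Function.update_of_ne hkj]
        exact hb k hk
    rw [← Finset.add_sum_erase s _ hj, Function.update_self,
      Finset.sum_congr rfl fun k hk => Function.update_of_ne (Finset.ne_of_mem_erase hk) _ b] at this
    linarith
  refine ⟨htop, le_of_forall_pos_le_add fun ε hε => ?_⟩
  have hd : 0 < ε / (s.card + 1) := by positivity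
  have := h (fun k => (f k).toReal - ε / (s.card + 1)) fun k hk => by
    conv_rhs => rw [← EReal.coe_toReal (htop k hk) (hf k hk)]
    rw [EReal.coe_lt_coe_iff]
    linarith
  rw [Finset.sum_sub_distrib, Finset.sum_const, _root_.nsmul_eq_mul] at this
  have h2 : (s.card : ℝ) * (ε / (s.card + 1)) ≤ ε := by
    rw [mul_div_assoc', div_le_iff₀ (by positivity)]
    nlinarith
  linarith

/-! ### Stability and attainment in the conjugacy formula for `φ₁`. -/

section WellPosed

variable {n N : ℕ} [NeZero N] {μ : Fin N → Measure (Eucl n)} {φ : Fin N → Eucl n → EReal}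

theorem IsDualAdmissible.isAffineSup_reducedPotential
    (hprob : ∀ k, IsProbabilityMeasure (μ k)) (h : IsDualAdmissible μ φ) (j : Fin N) :
    IsAffineSup (reducedPotential μ φ j) := by
  obtain ⟨x₀, hx₀⟩ := h.exists_mem_support hprob
  exact IsAffineSup.of_iSup_sub h.ne_bot (s := otherIndices j)
    (A := {x | ∀ k ∈ otherIndices j, x k ∈ (μ k).support})
    ⟨x₀, fun k _ => (hx₀ k).1, fun k _ => (hx₀ k).2⟩
    (fun x => ∑ k ∈ otherIndices j, x k) (pairSum (otherIndices j)) fun t => rfl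

theorem le_reducedPotential {j : Fin N} (hbot : ∀ k x, φ k x ≠ ⊥) {x : Fin N → Eucl n}
    (hx : ∀ k ∈ otherIndices j, x k ∈ (μ k).support)
    (hxt : ∀ k ∈ otherIndices j, φ k (x k) ≠ ⊤) (t : Eucl n) :
    ((inner ℝ t (∑ k ∈ otherIndices j, x k) + pairSum (otherIndices j) x
      - ∑ k ∈ otherIndices j, (φ k (x k)).toReal : ℝ) : EReal) ≤ reducedPotential μ φ j t := by
  rw [EReal.coe_sub, ← EReal.sum_eq_coe_sum_toReal (fun k _ => hbot k _) hxt]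
  exact le_iSup₂ (f := fun (x : Fin N → Eucl n) (_ : ∀ k ∈ otherIndices j, x k ∈ (μ k).support) =>
    ((inner ℝ t (∑ k ∈ otherIndices j, x k) + pairSum (otherIndices j) x : ℝ) : EReal)
      - ∑ k ∈ otherIndices j, φ k (x k)) x hx

/-- The conjugacy formula for `φ₁(z)` with `x_j` frozen at `w`, split by `surplus_eq_otherIndices`.
Near maximizers almost reach equality here. -/
theorem reducedPotential_add_le (hbot : ∀ k x, φ k x ≠ ⊥) (hc : IsConjugateTuple μ φ)
    {j : Fin N} (hj : j ≠ 0) {z w : Eucl n} (hz : φ 0 z ≠ ⊤) (hw : w ∈ (μ j).support)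
    (hwt : φ j w ≠ ⊤) :
    reducedPotential μ φ j (z + w)
      ≤ (((φ 0 z).toReal + (φ j w).toReal - inner ℝ z w : ℝ) : EReal) := by
  refine iSup₂_le fun x hx => ?_
  by_cases hxt : ∀ k ∈ otherIndices j, φ k (x k) ≠ ⊤
  · rw [EReal.sum_eq_coe_sum_toReal (fun k _ => hbot k _) hxt, ← EReal.coe_sub,
      EReal.coe_le_coe_iff]
    set x' := Function.update (Function.update x 0 z) j w
    have hO : ∀ k ∈ otherIndices j, x' k = x k := fun k hk => by
      have : k ≠ 0 ∧ k ≠ j := by simpa [otherIndices] using hk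
      simp [x', this.1, this.2]
    have hx'0 : x' 0 = z := by simp [x', hj.symm]
    have hx'j : x' j = w := by simp [x']
    have h1 := le_surplusConj (μ := μ) φ (j := 0) (x := x') fun k hk => by
      by_cases hkj : k = j
      · subst hkj; rw [hx'j]; exact hw
      · have : k ∈ otherIndices j := by simp [otherIndices, hk, hkj]
        rw [hO k this]; exact hx k this
    rw [← hc.eq_surplusConj 0 (x' 0), hx'0, surplus_eq_otherIndices hj, univ_erase_zero_eq hj,
      Finset.sum_insert (notMem_otherIndices j), hx'0, hx'j, Finset.sum_congr rfl hO,
      pairSum_congr hO, Finset.sum_congr rfl fun k hk => congrArg (φ k) (hO k hk),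
      EReal.sum_eq_coe_sum_toReal (fun k _ => hbot k _) hxt,
      ← EReal.coe_toReal hwt (hbot j w), ← EReal.coe_toReal hz (hbot 0 z), ← EReal.coe_add,
      ← EReal.coe_sub, EReal.coe_le_coe_iff] at h1
    change inner ℝ (z + w) (∑ k ∈ otherIndices j, x k) + pairSum (otherIndices j) x - _ ≤ _
    linarith
  · push Not at hxt
    obtain ⟨k, hk, hkt⟩ := hxt
    rw [EReal.sum_eq_top (fun k _ => hbot k _) hk hkt, EReal.sub_top]
    exact bot_le

theorem IsDualAdmissible.exists_reducedPotential_ne_top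
    (hprob : ∀ k, IsProbabilityMeasure (μ k)) (h : IsDualAdmissible μ φ)
    (hc : IsConjugateTuple μ φ) {j : Fin N} (hj : j ≠ 0) :
    ∃ t, reducedPotential μ φ j t ≠ ⊤ := by
  obtain ⟨x₀, hx₀⟩ := h.exists_mem_support hprob
  refine ⟨x₀ 0 + x₀ j, fun htop => ?_⟩
  have := reducedPotential_add_le h.ne_bot hc hj (hx₀ 0).2 (hx₀ j).1 (hx₀ j).2
  rw [htop] at this
  exact EReal.coe_ne_top _ (top_le_iff.1 this)

/-- The map `x ↦ Du_j^*(x + Dφ₁(x)) - x` for `j ≠ 1`, and the identity for `j = 1`. -/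
noncomputable def transportMap (μ : Fin N → Measure (Eucl n)) (φ : Fin N → Eucl n → EReal)
    (j : Fin N) (x : Eucl n) : Eucl n :=
  if j = 0 then x else egrad (legendre (uFun μ φ j)) (x + egrad (φ 0) x) - x

/-- `x` is, up to `δ`, a maximizer in the definition of the conjugate `φ₁(x₁)`. -/
def IsNearMaximizer (μ : Fin N → Measure (Eucl n)) (φ : Fin N → Eucl n → EReal) (δ : ℝ)
    (x : Fin N → Eucl n) : Prop :=
  (∀ k, k ≠ 0 → x k ∈ (μ k).support) ∧ (∀ k, k ≠ 0 → φ k (x k) ≠ ⊤) ∧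
    (φ 0 (x 0)).toReal - δ ≤ surplus x - ∑ k ∈ Finset.univ.erase 0, (φ k (x k)).toReal

theorem IsNearMaximizer.mono {δ δ' : ℝ} {x : Fin N → Eucl n} (h : IsNearMaximizer μ φ δ x)
    (hδ : δ ≤ δ') : IsNearMaximizer μ φ δ' x :=
  ⟨h.1, h.2.1, by linarith [h.2.2]⟩

/-- The surplus is affine in the first point with slope the sum of the others; moving only that
point shows this sum to be a `δ`-subgradient of `φ₁`. -/
theorem IsNearMaximizer.le_apply_zero (hbot : ∀ k x, φ k x ≠ ⊥) (hc : IsConjugateTuple μ φ)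
    {δ : ℝ} {x : Fin N → Eucl n} (h : IsNearMaximizer μ φ δ x) (y : Eucl n) :
    (((φ 0 (x 0)).toReal - δ + inner ℝ (y - x 0) (∑ k ∈ Finset.univ.erase 0, x k) : ℝ) : EReal)
      ≤ φ 0 y := by
  have hu : ∀ k ∈ Finset.univ.erase 0, Function.update x 0 y k = x k := fun k hk =>
    Function.update_of_ne (Finset.ne_of_mem_erase hk) _ _
  have h1 := le_surplusConj (μ := μ) φ (j := 0) (x := Function.update x 0 y) fun k hk => by
    rw [Function.update_of_ne hk]
    exact h.1 k hk
  rw [← hc.eq_surplusConj 0 _, Function.update_self, surplus_eq_inner_add _ 0, Finset.sum_congr rfl hu,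
    pairSum_congr hu, Finset.sum_congr rfl fun k hk => congrArg (φ k) (hu k hk),
    EReal.sum_eq_coe_sum_toReal (fun k _ => hbot k _)
      (fun k hk => h.2.1 k (Finset.ne_of_mem_erase hk)), ← EReal.coe_sub,
    Function.update_self] at h1
  refine le_trans (EReal.coe_le_coe_iff.2 ?_) h1
  have h2 := h.2.2
  rw [surplus_eq_inner_add x 0] at h2
  rw [inner_sub_left]
  linarith

/-- The points other than `x₁`, `x_j` nearly attain `ψ_j(x₁ + x_j)`, so their sum is a
`δ`-subgradient there. It is written as the total sum minus `x₁ + x_j` to fit `IsProx.norm_sub_le`.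
-/
theorem IsNearMaximizer.le_reducedPotential (hbot : ∀ k x, φ k x ≠ ⊥)
    (hc : IsConjugateTuple μ φ) {δ : ℝ} {x : Fin N → Eucl n} (h : IsNearMaximizer μ φ δ x)
    (h0 : φ 0 (x 0) ≠ ⊤) {j : Fin N} (hj : j ≠ 0) :
    reducedPotential μ φ j (x 0 + x j) ≠ ⊤ ∧ ∀ s,
      (((reducedPotential μ φ j (x 0 + x j)).toReal - δ + inner ℝ (s - (x 0 + x j))
        (x 0 + ∑ k ∈ Finset.univ.erase 0, x k - (x 0 + x j)) : ℝ) : EReal)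
        ≤ reducedPotential μ φ j s := by
  have hO : ∀ k ∈ otherIndices j, k ≠ 0 := fun k hk => by
    have : k ≠ 0 ∧ k ≠ j := by simpa [otherIndices] using hk
    exact this.1
  have hle := reducedPotential_add_le hbot hc hj h0 (h.1 j hj) (h.2.1 j hj)
  have hge := _root_.le_reducedPotential hbot (fun k hk => h.1 k (hO k hk))
    (fun k hk => h.2.1 k (hO k hk))
  have htop : reducedPotential μ φ j (x 0 + x j) ≠ ⊤ := fun htop => by
    rw [htop] at hle
    exact EReal.coe_ne_top _ (top_le_iff.1 hle)
  have hbt : reducedPotential μ φ j (x 0 + x j) ≠ ⊥ := fun hb => by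
    have := hge (x 0 + x j)
    rw [hb] at this
    exact EReal.coe_ne_bot _ (le_bot_iff.1 this)
  refine ⟨htop, fun s => le_trans (EReal.coe_le_coe_iff.2 ?_) (hge s)⟩
  rw [← EReal.coe_toReal htop hbt, EReal.coe_le_coe_iff] at hle
  have h2 := h.2.2
  rw [surplus_eq_otherIndices hj, univ_erase_zero_eq hj,
    Finset.sum_insert (notMem_otherIndices j)] at h2
  rw [univ_erase_zero_eq hj, Finset.sum_insert (notMem_otherIndices j), ← add_assoc,
    add_sub_cancel_left, inner_sub_left]
  linarith

/-- By differentiability the sum of the other points is close to `Dφ₁(x₀)`, and `x₀ + x_j` is an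
approximate proximal point of `x₀` plus that sum. Stability of proximal points then places it near
that of `x₀ + Dφ₁(x₀)`, which is `Du_j^*` there. -/
theorem exists_norm_sub_transportMap_le (hprob : ∀ k, IsProbabilityMeasure (μ k))
    (h : IsDualAdmissible μ φ) (hc : IsConjugateTuple μ φ) {x₀ : Eucl n}
    (hd : EDifferentiableAt (φ 0) x₀) {η : ℝ} (hη : 0 < η) :
    ∃ δ > 0, ∀ x, x 0 = x₀ → IsNearMaximizer μ φ δ x →
      ∀ j, ‖x j - transportMap μ φ j x₀‖ ≤ η := by
  obtain ⟨δ, hδ, hδ'⟩ := hd.exists_norm_sub_egrad_le (half_pos hη)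
  -- The distance `q` will satisfy `q² ≤ q * (η / 2) + η² / 4`, which is impossible for `q > η`.
  refine ⟨min δ (η ^ 2 / 4), by positivity, ?_⟩
  rintro x rfl hx j
  by_cases hj : j = 0
  · subst hj
    simpa [transportMap] using hη.le
  have h1 := hδ' _ ((hx.mono (min_le_left _ _)).le_apply_zero h.ne_bot hc)
  obtain ⟨h2, h3⟩ := (hx.mono (min_le_right _ _)).le_reducedPotential h.ne_bot hc
    hd.1.self_of_nhds.2 hj
  have hS := h.isAffineSup_reducedPotential hprob j
  have h4 := IsProx.norm_sub_le hS (hS.isProx_egrad_legendre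
    (h.exists_reducedPotential_ne_top hprob hc hj) (x 0 + egrad (φ 0) (x 0))) h2 h3
  rw [add_sub_add_left_eq_sub] at h4
  rw [transportMap, if_neg hj]
  change ‖x j - (egrad (legendre (quadAdd (reducedPotential μ φ j))) _ - x 0)‖ ≤ η
  rw [← sub_add, sub_add_eq_add_sub, add_comm (x j)]
  set q := ‖x 0 + x j - egrad (legendre (quadAdd (reducedPotential μ φ j)))
    (x 0 + egrad (φ 0) (x 0))‖
  have hq : 0 ≤ q := norm_nonneg _
  by_contra hlt
  push Not at hlt
  nlinarith

theorem eq_transportMap (hprob : ∀ k, IsProbabilityMeasure (μ k))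
    (h : IsDualAdmissible μ φ) (hc : IsConjugateTuple μ φ) {x : Fin N → Eucl n}
    (hd : EDifferentiableAt (φ 0) (x 0)) (hx : IsNearMaximizer μ φ 0 x) (j : Fin N) :
    x j = transportMap μ φ j (x 0) := by
  refine eq_of_sub_eq_zero (norm_le_zero_iff.1 (le_of_forall_pos_le_add fun η hη => ?_))
  obtain ⟨δ, hδ, hδ'⟩ := exists_norm_sub_transportMap_le hprob h hc hd hη
  simpa using hδ' x rfl (hx.mono hδ.le) j

theorem exists_isNearMaximizer (hbot : ∀ k x, φ k x ≠ ⊥) (hc : IsConjugateTuple μ φ)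
    {x₀ : Eucl n} (h0 : φ 0 x₀ ≠ ⊤) {δ : ℝ} (hδ : 0 < δ) :
    ∃ x, x 0 = x₀ ∧ IsNearMaximizer μ φ δ x := by
  have hlt : (((φ 0 x₀).toReal - δ : ℝ) : EReal) < surplusConj μ φ 0 x₀ := by
    rw [← hc.eq_surplusConj 0 x₀]
    conv_rhs => rw [← EReal.coe_toReal h0 (hbot 0 x₀)]
    rw [EReal.coe_lt_coe_iff]
    linarith
  obtain ⟨x, hx⟩ := lt_iSup_iff.1 hlt
  obtain ⟨hx0, hx⟩ := lt_iSup_iff.1 hx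
  obtain ⟨hxs, hx⟩ := lt_iSup_iff.1 hx
  have htop : ∀ k ∈ Finset.univ.erase 0, φ k (x k) ≠ ⊤ := fun k hk hkt => by
    rw [EReal.sum_eq_top (fun k _ => hbot k _) hk hkt, EReal.sub_top] at hx
    exact not_lt_bot hx
  refine ⟨x, hx0, hxs, fun k hk => htop k (Finset.mem_erase.2 ⟨hk, Finset.mem_univ k⟩), ?_⟩
  rw [EReal.sum_eq_coe_sum_toReal (fun k _ => hbot k _) htop, ← EReal.coe_sub,
    EReal.coe_lt_coe_iff] at hx
  rw [hx0]
  exact hx.le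

/-- Near maximizers with error tending to `0` converge to this tuple. Closed supports, continuity of
the surplus and lower semicontinuity of the potentials make the limit an exact maximizer. -/
theorem isNearMaximizer_transportMap (hprob : ∀ k, IsProbabilityMeasure (μ k))
    (h : IsDualAdmissible μ φ) (hc : IsConjugateTuple μ φ) {x₀ : Eucl n}
    (hd : EDifferentiableAt (φ 0) x₀) :
    IsNearMaximizer μ φ 0 (fun j => transportMap μ φ j x₀) := by
  have h0 := hd.1.self_of_nhds.2
  choose x hx0 hx using fun m : ℕ =>
    exists_isNearMaximizer h.ne_bot hc h0 (Nat.one_div_pos_of_nat (α := ℝ) (n := m))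
  have hz : transportMap μ φ 0 x₀ = x₀ := by simp [transportMap]
  have hlim : ∀ j, Tendsto (fun m => x m j) atTop (𝓝 (transportMap μ φ j x₀)) := by
    intro j
    rw [Metric.tendsto_atTop]
    intro η hη
    obtain ⟨δ, hδ, hδ'⟩ := exists_norm_sub_transportMap_le hprob h hc hd (half_pos hη)
    obtain ⟨M, hM⟩ := exists_nat_one_div_lt hδ
    refine ⟨M, fun m hm => ?_⟩
    rw [dist_eq_norm]
    refine (hδ' (x m) (hx0 m) ((hx m).mono ?_) j).trans_lt (half_lt_self hη)
    exact (Nat.one_div_le_one_div hm).trans hM.le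
  have hsur : Tendsto (fun m => surplus (x m) - (φ 0 x₀).toReal + 1 / ((m : ℝ) + 1)) atTop
      (𝓝 (surplus (fun j => transportMap μ φ j x₀) - (φ 0 x₀).toReal + 0)) :=
    (((continuous_surplus.tendsto _).comp (tendsto_pi_nhds.2 hlim)).sub_const _).add
      tendsto_one_div_add_atTop_nhds_zero_nat
  have key := EReal.sum_le_of_forall_lt (Finset.univ.erase (0 : Fin N))
    (f := fun k => φ k (transportMap μ φ k x₀)) (fun k _ => h.ne_bot k _) fun a ha => by
      refine ge_of_tendsto hsur ?_
      have hev : ∀ᶠ m in atTop, ∀ k ∈ Finset.univ.erase (0 : Fin N),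
          (a k : EReal) < φ k (x m k) := by
        rw [Filter.eventually_all_finset]
        intro k hk
        exact (hlim k).eventually
          ((hc.isAffineSup hprob h k).lowerSemicontinuous _ _ (ha k hk))
      filter_upwards [hev] with m hm
      have h1 : ∑ k ∈ Finset.univ.erase (0 : Fin N), a k
          ≤ ∑ k ∈ Finset.univ.erase (0 : Fin N), (φ k (x m k)).toReal := by
        refine Finset.sum_le_sum fun k hk => ?_
        have := hm k hk
        rw [← EReal.coe_toReal ((hx m).2.1 k (Finset.ne_of_mem_erase hk)) (h.ne_bot k _),
          EReal.coe_lt_coe_iff] at this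
        exact this.le
      have h2 := (hx m).2.2
      rw [hx0 m] at h2
      linarith
  refine ⟨fun k hk => ?_, fun k hk => key.1 k (Finset.mem_erase.2 ⟨hk, Finset.mem_univ k⟩), ?_⟩
  · exact Measure.isClosed_support.mem_of_tendsto (hlim k)
      (Eventually.of_forall fun m => (hx m).1 k hk)
  · have := key.2
    simp only [hz]
    linarith

end WellPosed

/-! ### Real perturbations of potentials; measurability of gradients. -/

theorem surplusConj_le_coe_iff {n N : ℕ} {μ : Fin N → Measure (Eucl n)}
    {χ : Fin N → Eucl n → EReal} (hbot : ∀ k x, χ k x ≠ ⊥) {j : Fin N} {y : Eucl n} {r : ℝ} :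
    surplusConj μ χ j y ≤ r ↔ ∀ x : Fin N → Eucl n, x j = y →
      (∀ k, k ≠ j → x k ∈ (μ k).support) → (∀ k, k ≠ j → χ k (x k) ≠ ⊤) →
      surplus x - ∑ k ∈ Finset.univ.erase j, (χ k (x k)).toReal ≤ r := by
  rw [surplusConj_le_iff]
  refine forall_congr' fun x => forall_congr' fun _ => forall_congr' fun _ => ?_
  constructor
  · intro h ht
    rwa [EReal.sum_eq_coe_sum_toReal (fun k _ => hbot k _)
      (fun k hk => ht k (Finset.ne_of_mem_erase hk)), ← EReal.coe_sub, EReal.coe_le_coe_iff] at h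
  · intro h
    by_cases ht : ∀ k ∈ Finset.univ.erase j, χ k (x k) ≠ ⊤
    · rw [EReal.sum_eq_coe_sum_toReal (fun k _ => hbot k _) ht, ← EReal.coe_sub,
        EReal.coe_le_coe_iff]
      exact h fun k hk => ht k (Finset.mem_erase.2 ⟨hk, Finset.mem_univ k⟩)
    · push Not at ht
      obtain ⟨k, hk, hkt⟩ := ht
      rw [EReal.sum_eq_top (fun k _ => hbot k _) hk hkt, EReal.sub_top]
      exact bot_le

theorem EReal.add_coe_ne_top_iff {a : EReal} {r : ℝ} : a + r ≠ ⊤ ↔ a ≠ ⊤ := by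
  induction a <;> simp [← EReal.coe_add]

theorem EReal.add_coe_ne_bot {a : EReal} (ha : a ≠ ⊥) (r : ℝ) : a + r ≠ ⊥ := by
  simp [EReal.add_eq_bot_iff, ha]

theorem EReal.toReal_add_coe {a : EReal} (hb : a ≠ ⊥) (ht : a ≠ ⊤) (r : ℝ) :
    (a + r).toReal = a.toReal + r := by
  rw [EReal.toReal_add ht hb (EReal.coe_ne_top r) (EReal.coe_ne_bot r), EReal.toReal_coe]

theorem IsDualAdmissible.add_real {n N : ℕ} {μ : Fin N → Measure (Eucl n)}
    {φ : Fin N → Eucl n → EReal} (h : IsDualAdmissible μ φ) {p : Fin N → Eucl n → ℝ}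
    (hp : ∀ k, Integrable (p k) (μ k)) (hp0 : ∀ x : Fin N → Eucl n, 0 ≤ ∑ k, p k (x k)) :
    IsDualAdmissible μ (fun k x => φ k x + (p k x : EReal)) := by
  refine ⟨fun k x => EReal.add_coe_ne_bot (h.ne_bot k x) _, fun k => ?_, fun k => ?_,
    fun x hx => ?_⟩
  · filter_upwards [h.ae_ne_top k] with x hx using EReal.add_coe_ne_top_iff.2 hx
  · refine ((h.integrable k).add (hp k)).congr ?_
    filter_upwards [h.ae_ne_top k] with x hx
    exact (EReal.toReal_add_coe (h.ne_bot k x) hx _).symm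
  · rw [Finset.sum_add_distrib]
    have h1 : ((∑ k, p k (x k) : ℝ) : EReal) = ∑ k, (p k (x k) : EReal) := by
      rw [EReal.sum_eq_coe_sum_toReal (fun _ _ => EReal.coe_ne_bot _)
        fun _ _ => EReal.coe_ne_top _]
      simp
    rw [← h1]
    calc (surplus x : EReal) = surplus x + (0 : EReal) := (add_zero _).symm
      _ ≤ _ := add_le_add (h.le_sum x hx) (EReal.coe_le_coe_iff.2 (hp0 x))

theorem measurable_egrad {n : ℕ} (f : Eucl n → EReal) : Measurable (egrad f) := by
  unfold egrad gradient
  exact (InnerProductSpace.toDual ℝ (Eucl n)).symm.continuous.measurable.comp (measurable_fderiv ℝ _)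

/-! ### First variation of the dual problem. -/

section EulerLagrange

variable {n N : ℕ} [NeZero N] {μ : Fin N → Measure (Eucl n)} {φ : Fin N → Eucl n → EReal}

theorem measurable_transportMap (j : Fin N) : Measurable (transportMap μ φ j) := by
  unfold transportMap
  by_cases hj : j = 0
  · simp only [hj, if_true]
    exact measurable_id
  · simp only [hj, if_false]
    exact ((measurable_egrad _).comp (measurable_id.add (measurable_egrad _))).sub measurable_id

open BoundedContinuousFunction

/-- The perturbation `φ_j + ε g`, compensated by the constant `ε ‖g‖` added to `φ₁`. -/
noncomputable def perturbation (φ : Fin N → Eucl n → EReal) (j : Fin N) (g : Eucl n →ᵇ ℝ) (ε : ℝ)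
    (k : Fin N) (x : Eucl n) : EReal :=
  φ k x + ((if k = 0 then ε * ‖g‖ else if k = j then ε * g x else 0 : ℝ) : EReal)

theorem sum_toReal_perturbation {j : Fin N} (hj : j ≠ 0) (hbot : ∀ k x, φ k x ≠ ⊥)
    (g : Eucl n →ᵇ ℝ) (ε : ℝ) {x : Fin N → Eucl n} (hx : ∀ k, k ≠ 0 → φ k (x k) ≠ ⊤) :
    ∑ k ∈ Finset.univ.erase 0, (perturbation φ j g ε k (x k)).toReal
      = ∑ k ∈ Finset.univ.erase 0, (φ k (x k)).toReal + ε * g (x j) := by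
  have : ∀ k ∈ Finset.univ.erase (0 : Fin N), (perturbation φ j g ε k (x k)).toReal
      = (φ k (x k)).toReal + if k = j then ε * g (x j) else 0 := by
    intro k hk
    have hk0 := Finset.ne_of_mem_erase hk
    rw [perturbation, EReal.toReal_add_coe (hbot k _) (hx k hk0), if_neg hk0]
    by_cases hkj : k = j
    · subst hkj; simp
    · simp [hkj]
  rw [Finset.sum_congr rfl this, Finset.sum_add_distrib, Finset.sum_ite_eq']
  simp [hj]

theorem perturbation_ne_bot (hbot : ∀ k x, φ k x ≠ ⊥) (j : Fin N) (g : Eucl n →ᵇ ℝ) (ε : ℝ)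
    (k : Fin N) (x : Eucl n) : perturbation φ j g ε k x ≠ ⊥ :=
  EReal.add_coe_ne_bot (hbot k x) _

theorem surplusConj_perturbation_le_iff {j : Fin N} (hj : j ≠ 0) (hbot : ∀ k x, φ k x ≠ ⊥)
    (g : Eucl n →ᵇ ℝ) (ε : ℝ) {x₀ : Eucl n} {r : ℝ} :
    surplusConj μ (perturbation φ j g ε) 0 x₀ ≤ r ↔ ∀ x : Fin N → Eucl n, x 0 = x₀ →
      (∀ k, k ≠ 0 → x k ∈ (μ k).support) → (∀ k, k ≠ 0 → φ k (x k) ≠ ⊤) →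
      surplus x - ∑ k ∈ Finset.univ.erase 0, (φ k (x k)).toReal - ε * g (x j) ≤ r := by
  rw [surplusConj_le_coe_iff (perturbation_ne_bot hbot j g ε)]
  refine forall_congr' fun x => forall_congr' fun _ => forall_congr' fun _ => ?_
  simp only [perturbation, EReal.add_coe_ne_top_iff]
  refine forall_congr' fun hx => ?_
  have := sum_toReal_perturbation hj hbot g ε hx
  simp only [perturbation] at this
  rw [this, sub_add_eq_sub_sub]

theorem perturbation_isDualAdmissible (hprob : ∀ k, IsProbabilityMeasure (μ k))
    (h : IsDualAdmissible μ φ) {j : Fin N} (hj : j ≠ 0) (g : Eucl n →ᵇ ℝ) {ε : ℝ} (hε : 0 ≤ ε) :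
    IsDualAdmissible μ (perturbation φ j g ε) := by
  refine h.add_real (p := fun k x => if k = 0 then ε * ‖g‖ else if k = j then ε * g x else 0)
    (fun k => ?_) fun x => ?_
  · by_cases hk : k = 0
    · simp only [hk, if_true]; exact integrable_const _
    · by_cases hkj : k = j
      · simp only [hkj, hj, if_true, if_false]
        exact (g.integrable _).const_mul ε
      · simp [hk, hkj]
  · rw [← Finset.add_sum_erase _ _ (Finset.mem_univ (0 : Fin N)), if_pos rfl,
      ← Finset.add_sum_erase _ _ (Finset.mem_erase.2 ⟨hj, Finset.mem_univ j⟩), if_neg hj,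
      if_pos rfl, Finset.sum_eq_zero fun k hk => by
        simp only [Finset.mem_erase] at hk
        simp [hk.1, hk.2.1]]
    have := (abs_le.1 (g.norm_coe_le_norm (x j))).1
    nlinarith

theorem surplusConj_perturbation_le_add (hbot : ∀ k x, φ k x ≠ ⊥) (hc : IsConjugateTuple μ φ)
    {j : Fin N} (hj : j ≠ 0) (g : Eucl n →ᵇ ℝ) {ε : ℝ} (hε : 0 ≤ ε) {x₀ : Eucl n}
    (h0 : φ 0 x₀ ≠ ⊤) :
    surplusConj μ (perturbation φ j g ε) 0 x₀ ≤ (((φ 0 x₀).toReal + ε * ‖g‖ : ℝ) : EReal) := by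
  have hle : surplusConj μ φ 0 x₀ ≤ ((φ 0 x₀).toReal : EReal) := by
    rw [← hc.eq_surplusConj, EReal.coe_toReal h0 (hbot 0 x₀)]
  rw [surplusConj_le_coe_iff hbot] at hle
  rw [surplusConj_perturbation_le_iff hj hbot]
  intro x hx0 hxs hxt
  have h1 := hle x hx0 hxs hxt
  have h2 := (abs_le.1 (g.norm_coe_le_norm (x j))).1
  nlinarith

theorem surplusConj_perturbation_bounds (hprob : ∀ k, IsProbabilityMeasure (μ k))
    (h : IsDualAdmissible μ φ) (hc : IsConjugateTuple μ φ) {j : Fin N} (hj : j ≠ 0)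
    (g : Eucl n →ᵇ ℝ) {ε : ℝ} (hε : 0 ≤ ε) {x₀ : Eucl n} (hd : EDifferentiableAt (φ 0) x₀) :
    (φ 0 x₀).toReal - ε * g (transportMap μ φ j x₀)
        ≤ (surplusConj μ (perturbation φ j g ε) 0 x₀).toReal ∧
      (surplusConj μ (perturbation φ j g ε) 0 x₀).toReal ≤ (φ 0 x₀).toReal + ε * ‖g‖ := by
  have hle := surplusConj_perturbation_le_add h.ne_bot hc hj g hε hd.1.self_of_nhds.2
  have hS := (perturbation_isDualAdmissible hprob h hj g hε).isAffineSup_surplusConj hprob 0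
  have htop : surplusConj μ (perturbation φ j g ε) 0 x₀ ≠ ⊤ := fun ht => by
    rw [ht] at hle
    exact EReal.coe_ne_top _ (top_le_iff.1 hle)
  have heq := EReal.coe_toReal htop (hS.ne_bot x₀)
  refine ⟨?_, by rwa [← heq, EReal.coe_le_coe_iff] at hle⟩
  obtain ⟨h1, h2, h3⟩ := isNearMaximizer_transportMap hprob h hc hd
  have hz : transportMap μ φ 0 x₀ = x₀ := by simp [transportMap]
  have := (surplusConj_perturbation_le_iff hj h.ne_bot g ε).1 heq.ge _ hz h1 h2
  simp only [hz] at h3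
  linarith

/-- A competitor is either `δ`-near maximal for `φ`, and then `g(x_j)` is within `η` of
`g(T_j(x₀))`, or it falls short by more than `δ`, which a perturbation with `2ε‖g‖ < δ` cannot
recover. -/
theorem eventually_surplusConj_perturbation_le (hprob : ∀ k, IsProbabilityMeasure (μ k))
    (h : IsDualAdmissible μ φ) (hc : IsConjugateTuple μ φ) {j : Fin N} (hj : j ≠ 0)
    (g : Eucl n →ᵇ ℝ) {x₀ : Eucl n} (hd : EDifferentiableAt (φ 0) x₀) {η : ℝ} (hη : 0 < η) :
    ∀ᶠ ε in 𝓝[>] (0 : ℝ), (surplusConj μ (perturbation φ j g ε) 0 x₀).toReal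
      ≤ (φ 0 x₀).toReal - ε * g (transportMap μ φ j x₀) + ε * η := by
  have h0 := hd.1.self_of_nhds.2
  obtain ⟨ρ, hρ, hcont⟩ := Metric.continuousAt_iff.1
    (g.continuous.continuousAt (x := transportMap μ φ j x₀)) η hη
  obtain ⟨δ, hδ, hwell⟩ := exists_norm_sub_transportMap_le hprob h hc hd (half_pos hρ)
  have hsmall : ∀ᶠ ε in 𝓝[>] (0 : ℝ), ε * (2 * ‖g‖) < δ := by
    have : Tendsto (fun ε : ℝ => ε * (2 * ‖g‖)) (𝓝 0) (𝓝 (0 * (2 * ‖g‖))) :=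
      (continuous_id.mul continuous_const).tendsto 0
    rw [zero_mul] at this
    exact nhdsWithin_le_nhds (this.eventually_lt_const hδ)
  filter_upwards [hsmall, self_mem_nhdsWithin] with ε hε hε0
  have hε0 : 0 < ε := hε0
  have hS := (perturbation_isDualAdmissible hprob h hj g hε0.le).isAffineSup_surplusConj hprob 0
  have hle : surplusConj μ φ 0 x₀ ≤ ((φ 0 x₀).toReal : EReal) := by
    rw [← hc.eq_surplusConj, EReal.coe_toReal h0 (h.ne_bot 0 x₀)]
  rw [surplusConj_le_coe_iff h.ne_bot] at hle
  have key : surplusConj μ (perturbation φ j g ε) 0 x₀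
      ≤ (((φ 0 x₀).toReal - ε * g (transportMap μ φ j x₀) + ε * η : ℝ) : EReal) := by
    rw [surplusConj_perturbation_le_iff hj h.ne_bot]
    intro x hx0 hxs hxt
    have h1 := hle x hx0 hxs hxt
    by_cases hnear : (φ 0 x₀).toReal - δ
        ≤ surplus x - ∑ k ∈ Finset.univ.erase 0, (φ k (x k)).toReal
    · have h2 := hwell x hx0 ⟨hxs, hxt, by rwa [hx0]⟩ j
      have h3 := hcont (by rw [dist_eq_norm]; linarith : dist (x j) (transportMap μ φ j x₀) < ρ)
      have h4 := (abs_lt.1 (Real.dist_eq _ _ ▸ h3)).1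
      nlinarith
    · have h2 := (abs_le.1 (g.norm_coe_le_norm (x j))).1
      have h3 := (abs_le.1 (g.norm_coe_le_norm (transportMap μ φ j x₀))).2
      push Not at hnear
      nlinarith [mul_pos hε0 hη]
  have htop : surplusConj μ (perturbation φ j g ε) 0 x₀ ≠ ⊤ := fun ht => by
    rw [ht] at key
    exact EReal.coe_ne_top _ (top_le_iff.1 key)
  rwa [← EReal.coe_toReal htop (hS.ne_bot x₀), EReal.coe_le_coe_iff] at key

theorem tendsto_surplusConj_perturbation (hprob : ∀ k, IsProbabilityMeasure (μ k))
    (h : IsDualAdmissible μ φ) (hc : IsConjugateTuple μ φ) {j : Fin N} (hj : j ≠ 0)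
    (g : Eucl n →ᵇ ℝ) {x₀ : Eucl n} (hd : EDifferentiableAt (φ 0) x₀) :
    Tendsto (fun ε => ((surplusConj μ (perturbation φ j g ε) 0 x₀).toReal - (φ 0 x₀).toReal) / ε)
      (𝓝[>] 0) (𝓝 (-g (transportMap μ φ j x₀))) := by
  rw [tendsto_order]
  constructor
  · intro a ha
    filter_upwards [self_mem_nhdsWithin] with ε hε
    have hε : 0 < ε := hε
    rw [lt_div_iff₀ hε]
    have := (surplusConj_perturbation_bounds hprob h hc hj g hε.le hd).1
    nlinarith
  · intro a ha
    filter_upwards [self_mem_nhdsWithin, eventually_surplusConj_perturbation_le hprob h hc hj g hd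
      (half_pos (sub_pos.2 ha))] with ε hε hle
    have hε : 0 < ε := hε
    rw [div_lt_iff₀ hε]
    nlinarith

theorem integral_surplusConj_perturbation_ge (hprob : ∀ k, IsProbabilityMeasure (μ k))
    (hmom : ∀ k, Integrable (fun x => ‖x‖ ^ 2) (μ k)) (h : IsDualSolution μ φ) {j : Fin N}
    (hj : j ≠ 0) (g : Eucl n →ᵇ ℝ) {ε : ℝ} (hε : 0 < ε) :
    Integrable (fun x => (surplusConj μ (perturbation φ j g ε) 0 x).toReal) (μ 0) ∧
    -∫ x, g x ∂μ j ≤ ∫ x, ((surplusConj μ (perturbation φ j g ε) 0 x).toReal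
      - (φ 0 x).toReal) / ε ∂μ 0 := by
  -- The compensating constant serves only to make the perturbed tuple admissible. Conjugating at
  -- the first index discards it, since that conjugate does not involve the first potential.
  have hadm := (perturbation_isDualAdmissible hprob h.1 hj g hε.le).update hprob hmom 0
  have hi := hadm.integrable 0
  rw [Function.update_self] at hi
  refine ⟨hi, ?_⟩
  have h1 := h.2 _ hadm
  rw [← Finset.add_sum_erase _ _ (Finset.mem_univ (0 : Fin N)),
    ← Finset.add_sum_erase _ _ (Finset.mem_univ (0 : Fin N)), Function.update_self] at h1
  have h2 : ∀ k ∈ Finset.univ.erase (0 : Fin N), ∫ x, (Function.update (perturbation φ j g ε) 0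
      (surplusConj μ (perturbation φ j g ε) 0) k x).toReal ∂μ k
      = ∫ x, (φ k x).toReal ∂μ k + if k = j then ε * ∫ x, g x ∂μ j else 0 := by
    intro k hk
    have hk0 := Finset.ne_of_mem_erase hk
    rw [Function.update_of_ne hk0]
    have : (fun x => (perturbation φ j g ε k x).toReal) =ᵐ[μ k]
        fun x => (φ k x).toReal + if k = j then ε * g x else 0 := by
      filter_upwards [h.1.ae_ne_top k] with x hx
      rw [perturbation, EReal.toReal_add_coe (h.1.ne_bot k x) hx, if_neg hk0]
    rw [integral_congr_ae this]
    by_cases hkj : k = j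
    · subst hkj
      simp only [if_true]
      rw [integral_add (h.1.integrable k) ((g.integrable _).const_mul ε), integral_const_mul]
    · simp [hkj]
  rw [Finset.sum_congr rfl h2, Finset.sum_add_distrib, Finset.sum_ite_eq',
    if_pos (Finset.mem_erase.2 ⟨hj, Finset.mem_univ j⟩)] at h1
  rw [integral_div, integral_sub hi (h.1.integrable 0), le_div_iff₀ hε]
  linarith

/-- Dual optimality bounds the difference quotients' integrals below; dominated convergence with
bound `‖g‖` turns this into an inequality between integrals of `g`, and using `-g` as well gives
equality. -/
theorem map_transportMap (hprob : ∀ k, IsProbabilityMeasure (μ k))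
    (hmom : ∀ k, Integrable (fun x => ‖x‖ ^ 2) (μ k)) (h : IsDualSolution μ φ)
    (hc : IsConjugateTuple μ φ) (hd : ∀ᵐ x ∂μ 0, EDifferentiableAt (φ 0) x) (j : Fin N) :
    (μ 0).map (transportMap μ φ j) = μ j := by
  by_cases hj : j = 0
  · subst hj
    have : transportMap μ φ 0 = id := funext fun x => by simp [transportMap]
    rw [this, Measure.map_id]
  have hT : Measurable (transportMap μ φ j) := measurable_transportMap j
  have key : ∀ g : Eucl n →ᵇ ℝ, ∫ x, g (transportMap μ φ j x) ∂μ 0 ≤ ∫ x, g x ∂μ j := by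
    intro g
    set e : ℕ → ℝ := fun m => 1 / ((m : ℝ) + 1)
    have he : ∀ m, 0 < e m := fun m => Nat.one_div_pos_of_nat
    have he0 : Tendsto e atTop (𝓝[>] 0) := tendsto_nhdsWithin_iff.2
      ⟨tendsto_one_div_add_atTop_nhds_zero_nat, Eventually.of_forall he⟩
    have hlim := tendsto_integral_of_dominated_convergence (μ := μ 0)
      (F := fun m x => ((surplusConj μ (perturbation φ j g (e m)) 0 x).toReal
        - (φ 0 x).toReal) / e m)
      (f := fun x => -g (transportMap μ φ j x)) (fun _ => ‖g‖)
      (fun m => (((integral_surplusConj_perturbation_ge hprob hmom h hj g (he m)).1.sub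
        (h.1.integrable 0)).div_const _).aestronglyMeasurable)
      (integrable_const _)
      (fun m => by
        filter_upwards [hd] with x hx
        obtain ⟨h1, h2⟩ := surplusConj_perturbation_bounds hprob h.1 hc hj g (he m).le hx
        have h3 := (abs_le.1 (g.norm_coe_le_norm (transportMap μ φ j x))).2
        have h4 := he m
        rw [Real.norm_eq_abs, abs_le, le_div_iff₀ h4, div_le_iff₀ h4]
        constructor <;> nlinarith)
      (by
        filter_upwards [hd] with x hx
        exact (tendsto_surplusConj_perturbation hprob h.1 hc hj g hx).comp he0)
    have hge := ge_of_tendsto' hlim fun m =>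
      (integral_surplusConj_perturbation_ge hprob hmom h hj g (he m)).2
    rw [integral_neg] at hge
    linarith
  have : IsProbabilityMeasure ((μ 0).map (transportMap μ φ j)) :=
    Measure.isProbabilityMeasure_map hT.aemeasurable
  refine ext_of_forall_integral_eq_of_IsFiniteMeasure fun g => ?_
  rw [integral_map hT.aemeasurable g.continuous.aestronglyMeasurable]
  refine le_antisymm (key g) ?_
  have := key (-g)
  simp only [BoundedContinuousFunction.coe_neg, Pi.neg_apply, integral_neg] at this
  linarith

end EulerLagrange

/-! ### Strong duality and concentration on the graph. -/

section Optimality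

variable {n N : ℕ} [NeZero N] {μ : Fin N → Measure (Eucl n)} {φ : Fin N → Eucl n → EReal}

theorem measurable_transportMap_pi :
    Measurable (fun x j => transportMap μ φ j x : Eucl n → Fin N → Eucl n) :=
  measurable_pi_lambda _ measurable_transportMap

theorem map_transportMap_mem_plans (hprob : ∀ k, IsProbabilityMeasure (μ k))
    (hmom : ∀ k, Integrable (fun x => ‖x‖ ^ 2) (μ k)) (h : IsDualSolution μ φ)
    (hc : IsConjugateTuple μ φ) (hd : ∀ᵐ x ∂μ 0, EDifferentiableAt (φ 0) x) :
    (μ 0).map (fun x j => transportMap μ φ j x) ∈ plans μ := by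
  refine ⟨Measure.isProbabilityMeasure_map measurable_transportMap_pi.aemeasurable, fun k => ?_⟩
  rw [Measure.map_map (measurable_pi_apply k) measurable_transportMap_pi]
  exact map_transportMap hprob hmom h hc hd k

theorem sum_integral_le_integral_surplus_transportMap (hprob : ∀ k, IsProbabilityMeasure (μ k))
    (hmom : ∀ k, Integrable (fun x => ‖x‖ ^ 2) (μ k)) (h : IsDualSolution μ φ)
    (hc : IsConjugateTuple μ φ) (hd : ∀ᵐ x ∂μ 0, EDifferentiableAt (φ 0) x) :
    ∑ k, ∫ x, (φ k x).toReal ∂μ k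
      ≤ ∫ x, surplus x ∂(μ 0).map (fun x j => transportMap μ φ j x) := by
  have hT := measurable_transportMap_pi (μ := μ) (φ := φ)
  have hpres : ∀ k, MeasurePreserving (transportMap μ φ k) (μ 0) (μ k) := fun k =>
    ⟨measurable_transportMap k, map_transportMap hprob hmom h hc hd k⟩
  have hi : ∀ k, Integrable (fun x => (φ k (transportMap μ φ k x)).toReal) (μ 0) := fun k =>
    (hpres k).integrable_comp_of_integrable (h.1.integrable k)
  have h1 : ∀ k, ∫ x, (φ k x).toReal ∂μ k
      = ∫ x, (φ k (transportMap μ φ k x)).toReal ∂μ 0 := fun k => by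
    conv_lhs => rw [← (hpres k).map_eq]
    rw [integral_map (hpres k).measurable.aemeasurable]
    rw [(hpres k).map_eq]
    exact (h.1.integrable k).aestronglyMeasurable
  rw [integral_map hT.aemeasurable continuous_surplus.aestronglyMeasurable,
    Finset.sum_congr rfl fun k _ => h1 k, ← integral_finsetSum _ fun k _ => hi k]
  refine integral_mono_ae (integrable_finsetSum _ fun k _ => hi k) ?_ ?_
  · exact (integrable_surplus_of_mem_plans hmom
      (map_transportMap_mem_plans hprob hmom h hc hd)).comp_measurable hT
  · filter_upwards [hd] with x hx
    have h2 := (isNearMaximizer_transportMap hprob h.1 hc hx).2.2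
    rw [← Finset.add_sum_erase _ _ (Finset.mem_univ (0 : Fin N))]
    linarith

/-- Complementary slackness: `∑ φ_k - c` is nonnegative `Q`-a.e. with integral zero, so `Q`-almost
every point is an exact maximizer over its first coordinate, and such a maximizer is unique where
`φ₁` is differentiable. -/
theorem ae_eq_transportMap (hprob : ∀ k, IsProbabilityMeasure (μ k))
    (hmom : ∀ k, Integrable (fun x => ‖x‖ ^ 2) (μ k)) (h : IsDualSolution μ φ)
    (hc : IsConjugateTuple μ φ) (hd : ∀ᵐ x ∂μ 0, EDifferentiableAt (φ 0) x)
    {Q : Measure (Fin N → Eucl n)} (hQ : Q ∈ plans μ)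
    (hle : ∑ k, ∫ x, (φ k x).toReal ∂μ k ≤ ∫ x, surplus x ∂Q) :
    ∀ᵐ x ∂Q, ∀ j, x j = transportMap μ φ j (x 0) := by
  have hi : Integrable (fun x : Fin N → Eucl n => ∑ k, (φ k (x k)).toReal) Q :=
    integrable_finsetSum _ fun k _ => integrable_comp_of_mem_plans hQ (h.1.integrable k)
  have hs := integrable_surplus_of_mem_plans hmom hQ
  have hsupp : ∀ᵐ x ∂Q, ∀ k, x k ∈ (μ k).support := ae_all_iff.2 fun k =>
    ae_comp_of_mem_plans hQ (p := fun y => y ∈ (μ k).support) Measure.support_mem_ae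
  have htop : ∀ᵐ x ∂Q, ∀ k, φ k (x k) ≠ ⊤ := ae_all_iff.2 fun k =>
    ae_comp_of_mem_plans hQ (h.1.ae_ne_top k)
  have hnonneg : 0 ≤ᵐ[Q] fun x => ∑ k, (φ k (x k)).toReal - surplus x := by
    filter_upwards [hsupp, htop] with x h1 h2
    have := h.1.le_sum x h1
    rw [EReal.sum_eq_coe_sum_toReal (fun k _ => h.1.ne_bot k _) fun k _ => h2 k,
      EReal.coe_le_coe_iff] at this
    exact sub_nonneg.2 this
  have hzero : ∫ x, (∑ k, (φ k (x k)).toReal - surplus x) ∂Q = 0 := by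
    refine le_antisymm ?_ (integral_nonneg_of_ae hnonneg)
    rw [integral_sub hi hs, integral_finsetSum _ fun k _ =>
      integrable_comp_of_mem_plans hQ (h.1.integrable k),
      Finset.sum_congr rfl fun k _ => integral_comp_of_mem_plans hQ (h.1.integrable k)]
    linarith
  have hcontact := (integral_eq_zero_iff_of_nonneg_ae hnonneg (hi.sub hs)).1 hzero
  filter_upwards [hsupp, htop, hcontact, ae_comp_of_mem_plans hQ hd] with x h1 h2 h3 h4 j
  refine eq_transportMap hprob h.1 hc h4 ⟨fun k _ => h1 k, fun k _ => h2 k, ?_⟩ j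
  have h5 : ∑ k, (φ k (x k)).toReal - surplus x = 0 := h3
  rw [← Finset.add_sum_erase _ _ (Finset.mem_univ (0 : Fin N))] at h5
  linarith

end Optimality

/-! ### The main theorem. -/

theorem mainTheorem8 {n N : ℕ} [NeZero N] (hN : 2 ≤ N)
    (μ : Fin N → Measure (Eucl n)) (hprob : ∀ k, IsProbabilityMeasure (μ k))
    (hmom : ∀ k, Integrable (fun x => ‖x‖ ^ 2) (μ k))
    (hac : μ 0 ≪ (volume : Measure (Eucl n))) :
    (∀ P ∈ plans μ, Integrable surplus P) ∧
    ∃ P : Measure (Fin N → Eucl n),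
      IsOptimalPlan μ P ∧ (∀ Q, IsOptimalPlan μ Q → Q = P) ∧
      ∃ T : Fin N → Eucl n → Eucl n,
        (∀ j, Measurable (T j)) ∧ T 0 = id ∧
        P = (μ 0).map (fun x j => T j x) ∧
        (∃ φ, IsDualSolution μ φ ∧ IsConjugateTuple μ φ) ∧
        ∀ φ, IsDualSolution μ φ → IsConjugateTuple μ φ →
          (∀ᵐ x ∂μ 0, EDifferentiableAt (φ 0) x) ∧
          ∀ j, j ≠ 0 →
            IsProperStrictConvex (uFun μ φ j) ∧
            (∀ y, EDifferentiableAt (legendre (uFun μ φ j)) y) ∧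
            ∀ᵐ x ∂μ 0, T j x = egrad (legendre (uFun μ φ j)) (x + egrad (φ 0) x) - x := by
  have hdiff : ∀ φ, IsDualSolution μ φ → IsConjugateTuple μ φ →
      ∀ᵐ x ∂μ 0, EDifferentiableAt (φ 0) x := fun φ h hc =>
    (hc.isAffineSup hprob h.1 0).ae_eDifferentiableAt hac (h.1.ae_ne_top 0)
  obtain ⟨φ, h, hc⟩ := exists_conjugate_isDualSolution hprob hmom
  have hd := hdiff φ h hc
  have hP := map_transportMap_mem_plans hprob hmom h hc hd
  have hle := sum_integral_le_integral_surplus_transportMap hprob hmom h hc hd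
  have hT := measurable_transportMap_pi (μ := μ) (φ := φ)
  refine ⟨fun P hP => integrable_surplus_of_mem_plans hmom hP, _,
    ⟨hP, fun Q hQ => (h.1.realAdmissible.integral_surplus_le hmom hQ).trans hle⟩, fun Q hQ => ?_,
    transportMap μ φ, measurable_transportMap, funext fun x => by simp [transportMap], rfl,
    ⟨φ, h, hc⟩, fun φ' h' hc' => ⟨hdiff φ' h' hc', fun j hj => ?_⟩⟩
  · have hae := ae_eq_transportMap hprob hmom h hc hd hQ.1 (hle.trans (hQ.2 _ hP))
    have hid : (id : (Fin N → Eucl n) → _) =ᵐ[Q] fun x j => transportMap μ φ j (x 0) :=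
      hae.mono fun x hx => funext hx
    rw [← Measure.map_id (μ := Q), Measure.map_congr hid, ← hQ.1.2 0,
      Measure.map_map hT (measurable_pi_apply 0)]
    rfl
  · have hS := h'.1.isAffineSup_reducedPotential hprob j
    have hne := h'.1.exists_reducedPotential_ne_top hprob hc' hj
    refine ⟨hS.isProperStrictConvex_quadAdd hne, hS.eDifferentiableAt_legendre hne, ?_⟩
    -- `T` was built from `φ`, but its plan also attains the dual value of `φ'`, so it is
    -- concentrated on the graph of the map built from `φ'`.
    have hae := ae_eq_transportMap hprob hmom h' hc' (hdiff φ' h' hc') hP ((h'.2 φ h.1).trans hle)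
    filter_upwards [ae_of_ae_map hT.aemeasurable hae] with x hx
    have := hx j
    simpa [transportMap, hj] using this
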